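/- Let $\mu,\nu\in\mathbb{R}$ satisfy $\mu+\nu>-1$ and $\mu-\nu\in\mathbb{N}_0=\{0,1,2,\dots\}$, and let $J_\nu$ be the Bessel function of the first kind of order $\nu$. For $n\in\mathbb{N}_0$ let $P_n^{(\mu,\nu)}$ denote a monic polynomial of degree $n$ with complex coefficients such that $$\int_0^\infty P_n^{(\mu,\nu)}(x)\,x^{k+\mu}J_\nu(x)\,dx=0,\qquad k=0,\dots,n-1,$$ where the integrals are Abel limits, that is, $\int_0^\infty f(x)\,dx:=\lim_{s\to0^+}\int_0^\infty f(x)e^{-sx}\,dx$. (i) If $\mu-\nu$ is even, then for every $n\ge 0$ the polynomial $P_n^{(\mu,\nu)}$ exists and is unique; it is an even function if $n$ is even and an odd function if $n$ is odd. (ii) If $\mu-\nu$ is odd, then $P_n^{(\mu,\nu)}$ exists and is unique for every even $n\ge 0$, does not exist for any odd $n$, and is an even function whenever it exists. (iii) In all the cases where $P_n^{(\mu,\nu)}$ exists, all its zeros in $\mathbb{C}$ lie on the imaginary axis, and they are symmetric with respect to the real axis (counted with multiplicity). -/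

import Mathlib

open Set Filter Topology MeasureTheory

noncomputable section

/-- The Bessel function of the first kind `J_ν(x)` of real order `ν` for `x > 0`, by its power
series `∑ (-1)^k / (k! Γ(k + ν + 1)) (x / 2)^(2k + ν)`. At the poles of `Γ` Mathlib has
`Real.Gamma = 0`, so that those terms vanish, as they do under the convention `1 / Γ = 0`. -/
def besselJ (ν x : ℝ) : ℝ :=
  ∑' k : ℕ, (-1 : ℝ) ^ k / ((k.factorial : ℝ) * Real.Gamma ((k : ℝ) + ν + 1)) *
    (x / 2) ^ (2 * (k : ℝ) + ν)

/-- The integral of `f` over `(0, ∞)`, in the sense of Abel limits, exists and equals `L`: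
`lim_{s → 0+} ∫_0^∞ f(x) e^{-s x} dx = L`, the integrals for `s > 0` being convergent. -/
def HasAbelIntegral (f : ℝ → ℂ) (L : ℂ) : Prop :=
  (∀ s : ℝ, 0 < s → IntegrableOn (fun x : ℝ => f x * (Real.exp (-(s * x)) : ℂ)) (Ioi 0)) ∧
    Tendsto (fun s : ℝ => ∫ x in Ioi (0 : ℝ), f x * (Real.exp (-(s * x)) : ℂ)) (𝓝[>] 0) (𝓝 L)

/-- `p` is a monic polynomial of degree `n` that is orthogonal to `1, x, …, x^(n-1)` with respect
to the weight `x^μ J_ν(x)` on `(0, ∞)`, the integrals being Abel limits. -/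
def IsBesselOrthogonal (μ ν : ℝ) (n : ℕ) (p : Polynomial ℂ) : Prop :=
  p.Monic ∧ p.natDegree = n ∧
    ∀ k : ℕ, k < n →
      HasAbelIntegral
        (fun x : ℝ => p.eval (x : ℂ) * ((x ^ ((k : ℝ) + μ) * besselJ ν x : ℝ) : ℂ)) 0

end

/-! ### The entire function `x ^ (-ν) * J_ν x` -/

/-! Write `m = μ - ν`. Orthogonality depends only on the Abel moments of `x^(ν+M) J_ν` with `M ≥ m`.
These equal `2^(ν+M) Γ(ν + M/2 + 1/2) / Γ(1/2 - M/2)`: zero for odd `M`, and by reflection `(-4)^N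
2^ν π⁻¹ Γ(ν+N+1/2) Γ(N+1/2)` for `M = 2N` (`tendsto_besselLaplace`).

Up to a nonzero factor, the surviving moments are those of `-4XY` with `X`, `Y` independent Gamma
variables. In the variable `t = x²` one therefore has a positive measure on the negative half-axis
(`isPositiveOnNegAxis_gammaFunctional`). For such a functional, monic orthogonal polynomials exist,
are unique and have all zeros in `(-∞, 0]`.

Split `p = A(x²) + x B(x²)`. The vanishing moments decouple the conditions on `A` and `B`. One of
the two satisfies as many conditions as it has coefficients, hence is zero; if the other carries the
leading coefficient, it is the monic orthogonal polynomial in `t`. For odd `m` and odd `n` the part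
forced to vanish is the one with the leading coefficient, so no `p` exists. Finally `z² ≤ 0` puts
the zeros on the imaginary axis, where conjugation is `z ↦ -z`, and parity of `p` gives the
symmetry. -/

theorem Real.inv_Gamma_eq_self_mul_inv_Gamma_add_one (s : ℝ) :
    (Real.Gamma s)⁻¹ = s * (Real.Gamma (s + 1))⁻¹ := by
  rcases eq_or_ne s 0 with rfl | hs
  · simp [Real.Gamma_zero]
  · rw [Real.Gamma_add_one hs, mul_inv, mul_inv_cancel_left₀ hs]

/-- The `k`-th Taylor coefficient of `besselSeries ν`. -/
noncomputable def besselCoeff (ν : ℝ) (k : ℕ) : ℝ :=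
  (-1) ^ k * (k.factorial : ℝ)⁻¹ * (Real.Gamma (k + ν + 1))⁻¹

/-- `∑ (-1)^k w^k / (k! Γ(k + ν + 1))`. -/
noncomputable def besselSeries (ν w : ℝ) : ℝ := ∑' k : ℕ, besselCoeff ν k * w ^ k

/-- From `k ≥ -ν` on, the factor `s` in `1/Γ(s) = s/Γ(s+1)` is at least 1, so the sequence no longer
increases and its first values bound it. -/
theorem exists_abs_inv_Gamma_le (ν : ℝ) :
    ∃ C : ℝ, ∀ k : ℕ, |(Real.Gamma (k + ν + 1))⁻¹| ≤ C := by
  obtain ⟨N, hN⟩ := exists_nat_ge (-ν)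
  set a : ℕ → ℝ := fun k => |(Real.Gamma (k + ν + 1))⁻¹| with ha
  have hstep : ∀ k, N ≤ k → a (k + 1) ≤ a k := by
    intro k hk
    have hk' : (N : ℝ) ≤ k := by exact_mod_cast hk
    have h1 : 1 ≤ (k : ℝ) + ν + 1 := by linarith
    have h := Real.inv_Gamma_eq_self_mul_inv_Gamma_add_one ((k : ℝ) + ν + 1)
    have : a k = ((k : ℝ) + ν + 1) * a (k + 1) := by
      simp only [ha]
      rw [h, abs_mul, abs_of_pos (by linarith : (0 : ℝ) < k + ν + 1)]
      push_cast
      ring_nf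
    rw [this]
    exact le_mul_of_one_le_left (abs_nonneg _) h1
  have hsum : ∀ k ∈ Finset.range (N + 1), a k ≤ ∑ i ∈ Finset.range (N + 1), a i := fun k hk =>
    Finset.single_le_sum (f := a) (fun i _ => abs_nonneg _) hk
  refine ⟨∑ i ∈ Finset.range (N + 1), a i, fun k => ?_⟩
  rcases le_total k N with hk | hk
  · exact hsum k (by simp; omega)
  · induction k, hk using Nat.le_induction with
    | base => exact hsum N (by simp)
    | succ k hk ih => exact (hstep k hk).trans ih

theorem exists_abs_besselCoeff_mul_pow_le (ν : ℝ) :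
    ∃ C : ℝ, ∀ (R w : ℝ) (k : ℕ), |w| ≤ R →
      ‖besselCoeff ν k * w ^ k‖ ≤ C * (R ^ k / k.factorial) := by
  obtain ⟨C, hC⟩ := exists_abs_inv_Gamma_le ν
  refine ⟨C, fun R w k hw => ?_⟩
  have h1 : |w| ^ k ≤ R ^ k := pow_le_pow_left₀ (abs_nonneg _) hw k
  have h0 : (0 : ℝ) < k.factorial := by exact_mod_cast k.factorial_pos
  have hC0 : 0 ≤ C := (abs_nonneg _).trans (hC 0)
  have : ‖besselCoeff ν k * w ^ k‖
      = |(Real.Gamma (k + ν + 1))⁻¹| * (|w| ^ k / k.factorial) := by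
    rw [besselCoeff, Real.norm_eq_abs, abs_mul, abs_mul, abs_mul, abs_pow, abs_pow, abs_neg,
      abs_one, one_pow, abs_of_pos (inv_pos.2 h0)]
    ring
  rw [this]
  gcongr
  exact hC k

theorem summable_besselCoeff_mul_pow (ν w : ℝ) :
    Summable fun k : ℕ => besselCoeff ν k * w ^ k := by
  obtain ⟨C, hC⟩ := exists_abs_besselCoeff_mul_pow_le ν
  exact .of_norm_bounded ((Real.summable_pow_div_factorial |w|).mul_left C)
    fun k => hC |w| w k le_rfl

theorem besselCoeff_succ_mul (ν : ℝ) (k : ℕ) :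
    besselCoeff ν (k + 1) * (k + 1) = -besselCoeff (ν + 1) k := by
  have h0 : (k.factorial : ℝ) ≠ 0 := by exact_mod_cast k.factorial_ne_zero
  have h1 : (k : ℝ) + 1 ≠ 0 := by positivity
  rw [besselCoeff, besselCoeff, Nat.factorial_succ]
  push_cast
  rw [show (k : ℝ) + 1 + ν + 1 = k + (ν + 1) + 1 by ring]
  field_simp
  ring

theorem besselCoeff_eq_mul (ν : ℝ) (k : ℕ) :
    besselCoeff ν k = (ν + 1 + k) * besselCoeff (ν + 1) k := by
  rw [besselCoeff, besselCoeff, Real.inv_Gamma_eq_self_mul_inv_Gamma_add_one (k + ν + 1),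
    show (k : ℝ) + ν + 1 + 1 = k + (ν + 1) + 1 by ring]
  ring

theorem hasDerivAt_besselSeries (ν w : ℝ) :
    HasDerivAt (besselSeries ν) (-besselSeries (ν + 1) w) w := by
  obtain ⟨C, hC⟩ := exists_abs_besselCoeff_mul_pow_le (ν + 1)
  have hser : besselSeries ν
      = fun z => besselCoeff ν 0 + ∑' k : ℕ, besselCoeff ν (k + 1) * z ^ (k + 1) := by
    funext z
    rw [besselSeries, (summable_besselCoeff_mul_pow ν z).tsum_eq_zero_add]
    simp
  have hd := hasDerivAt_tsum_of_isPreconnected (𝕜 := ℝ)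
    (g := fun (k : ℕ) z => besselCoeff ν (k + 1) * z ^ (k + 1))
    (g' := fun (k : ℕ) z => -(besselCoeff (ν + 1) k * z ^ k))
    (t := Metric.ball (0 : ℝ) (|w| + 1)) (y₀ := 0) (y := w)
    ((Real.summable_pow_div_factorial (|w| + 1)).mul_left C) Metric.isOpen_ball
    (convex_ball _ _).isPreconnected
    (fun k y _ => by
      have h := (hasDerivAt_pow (k + 1) y).const_mul (besselCoeff ν (k + 1))
      refine h.congr_deriv ?_
      have := besselCoeff_succ_mul ν k
      push_cast
      rw [← neg_mul, ← this]
      ring)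
    (fun k y hy => by
      rw [norm_neg]
      exact hC _ y k (mem_ball_zero_iff.1 hy).le)
    (by simp; positivity)
    ((summable_nat_add_iff 1).2 (summable_besselCoeff_mul_pow ν 0))
    (by simp)
  rw [tsum_neg] at hd
  rw [hser]
  exact hd.const_add _

theorem besselSeries_eq (ν w : ℝ) :
    besselSeries ν w = (ν + 1) * besselSeries (ν + 1) w - w * besselSeries (ν + 2) w := by
  have h1 := summable_besselCoeff_mul_pow ν w
  have h2 := summable_besselCoeff_mul_pow (ν + 1) w
  have h3 := summable_besselCoeff_mul_pow (ν + 2) w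
  have e1 := h1.tsum_eq_zero_add
  have e2 := h2.tsum_eq_zero_add
  have h2' := (summable_nat_add_iff 1).2 h2
  simp only [besselSeries] at *
  rw [e1, e2, mul_add, ← tsum_mul_left, ← tsum_mul_left, add_sub_assoc,
    ← (h2'.mul_left _).tsum_sub (h3.mul_left _)]
  congr 1
  · rw [besselCoeff_eq_mul]
    simp
  · refine tsum_congr fun k => ?_
    have h := besselCoeff_succ_mul (ν + 1) k
    rw [show ν + 1 + 1 = ν + 2 by ring] at h
    rw [besselCoeff_eq_mul, show besselCoeff (ν + 2) k = -(besselCoeff (ν + 1) (k + 1) * (k + 1)) by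
      rw [h, neg_neg]]
    push_cast
    ring

/-- The entire function equal to `x ^ (-ν) * J_ν x` for `x > 0`. -/
noncomputable def besselEntire (ν x : ℝ) : ℝ := 2 ^ (-ν) * besselSeries ν (x ^ 2 / 4)

theorem besselJ_eq_rpow_mul_besselEntire (ν : ℝ) {x : ℝ} (hx : 0 < x) :
    besselJ ν x = x ^ ν * besselEntire ν x := by
  rw [besselEntire, besselSeries, besselJ, ← mul_assoc, ← tsum_mul_left]
  refine tsum_congr fun k => ?_
  have h2 : (0 : ℝ) < x / 2 := by positivity
  rw [Real.rpow_add h2, Real.rpow_mul h2.le, Real.div_rpow hx.le (by norm_num) ν,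
    Real.rpow_neg (by norm_num), besselCoeff, Real.rpow_natCast,
    show ((x / 2) ^ (2 : ℝ)) = x ^ 2 / 4 by rw [Real.rpow_two]; ring]
  have : (2 : ℝ) ^ ν ≠ 0 := by positivity
  field_simp

theorem hasDerivAt_besselEntire (ν x : ℝ) :
    HasDerivAt (besselEntire ν) (-(x * besselEntire (ν + 1) x)) x := by
  have h := ((hasDerivAt_besselSeries ν (x ^ 2 / 4)).comp x
    ((hasDerivAt_pow 2 x).div_const 4)).const_mul ((2 : ℝ) ^ (-ν))
  refine h.congr_deriv ?_
  rw [besselEntire, show -(ν + 1) = -ν - 1 by ring, Real.rpow_sub_one (by norm_num)]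
  norm_num
  ring

theorem continuous_besselEntire (ν : ℝ) : Continuous (besselEntire ν) :=
  continuous_iff_continuousAt.2 fun x => (hasDerivAt_besselEntire ν x).continuousAt

/-- The three-term recurrence in the order. With `hasDerivAt_besselEntire` it yields every identity
for the Laplace transforms below. -/
theorem besselEntire_eq (ν x : ℝ) :
    besselEntire ν x = 2 * (ν + 1) * besselEntire (ν + 1) x - x ^ 2 * besselEntire (ν + 2) x := by
  rw [besselEntire, besselEntire, besselEntire, besselSeries_eq, show -(ν + 1) = -ν - 1 by ring,
    show -(ν + 2) = -ν - 1 - 1 by ring, Real.rpow_sub_one (by norm_num),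
    Real.rpow_sub_one (by norm_num), Real.rpow_sub_one (by norm_num)]
  ring

theorem besselEntire_zero (ν : ℝ) : besselEntire ν 0 = 2 ^ (-ν) * (Real.Gamma (ν + 1))⁻¹ := by
  rw [besselEntire, besselSeries, tsum_eq_single 0]
  · simp [besselCoeff]
  · intro k hk
    simp [hk]

/-- Energy estimate: `E = u² + (xw)²` has derivative `-2(2ν+1) x w²`. Past `X = |2ν+1|/ε` this is at
most `2εE`, so `E e^(-2εx)` decreases. This covers orders below `-1/2`, where `E` may grow. -/
theorem exists_abs_besselEntire_le (ν : ℝ) {ε : ℝ} (hε : 0 < ε) :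
    ∃ C : ℝ, ∀ x : ℝ, 0 ≤ x → |besselEntire ν x| ≤ C * Real.exp (ε * x) := by
  set u := besselEntire ν
  set w := besselEntire (ν + 1)
  set X : ℝ := |2 * ν + 1| / ε with hX
  have hX0 : 0 ≤ X := by positivity
  have hw : ∀ x, HasDerivAt (fun x => x * w x) (u x - (2 * ν + 1) * w x) x := by
    intro x
    refine ((hasDerivAt_id x).mul (hasDerivAt_besselEntire (ν + 1) x)).congr_deriv ?_
    have := besselEntire_eq ν x
    rw [show ν + 1 + 1 = ν + 2 by ring]
    simp only [u, w, id, this]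
    ring
  have hE : ∀ x, HasDerivAt (fun x => (u x ^ 2 + (x * w x) ^ 2) * Real.exp (-(2 * ε * x)))
      (-(2 * ((2 * ν + 1) * x * w x ^ 2 + ε * (u x ^ 2 + (x * w x) ^ 2)))
        * Real.exp (-(2 * ε * x))) x := by
    intro x
    have h1 := (((hasDerivAt_besselEntire ν x).pow 2).add ((hw x).pow 2)).mul
      (((hasDerivAt_id x).const_mul (2 * ε)).neg.exp)
    refine h1.congr_deriv ?_
    simp [u, w]
    ring
  have hanti : AntitoneOn (fun x => (u x ^ 2 + (x * w x) ^ 2) * Real.exp (-(2 * ε * x)))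
      (Ici X) := by
    refine antitoneOn_of_deriv_nonpos (convex_Ici X)
      (fun x _ => (hE x).continuousAt.continuousWithinAt)
      (fun x _ => (hE x).differentiableAt.differentiableWithinAt) fun x hx => ?_
    rw [interior_Ici, mem_Ioi] at hx
    rw [(hE x).deriv]
    refine mul_nonpos_of_nonpos_of_nonneg ?_ (Real.exp_pos _).le
    have hx0 : 0 < x := hX0.trans_lt hx
    have h1 : |2 * ν + 1| ≤ ε * x := by
      rw [hX, div_lt_iff₀ hε] at hx
      linarith
    have h2 : -(ε * x) ≤ 2 * ν + 1 := (abs_le.1 h1).1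
    have h3 : 0 ≤ (2 * ν + 1 + ε * x) * (x * w x ^ 2) := by
      have : 0 ≤ 2 * ν + 1 + ε * x := by linarith
      positivity
    have h4 : 0 ≤ ε * u x ^ 2 := by positivity
    nlinarith
  obtain ⟨C, hC⟩ := (isCompact_Icc (a := (0 : ℝ)) (b := X)).exists_bound_of_continuousOn
    (continuous_besselEntire ν).continuousOn
  set D := Real.sqrt ((u X ^ 2 + (X * w X) ^ 2) * Real.exp (-(2 * ε * X)))
  have hC0 : 0 ≤ C := (norm_nonneg _).trans (hC 0 ⟨le_rfl, hX0⟩)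
  have hD0 : 0 ≤ D := Real.sqrt_nonneg _
  refine ⟨C + D, fun x hx => ?_⟩
  rcases le_total x X with h | h
  · have h1 := hC x ⟨hx, h⟩
    rw [Real.norm_eq_abs] at h1
    have h2 : 1 ≤ Real.exp (ε * x) := Real.one_le_exp (by positivity)
    nlinarith
  · have h1 := hanti (mem_Ici.2 le_rfl) (mem_Ici.2 h) h
    simp only at h1
    have h2 : (u x * Real.exp (-(ε * x))) ^ 2
        ≤ (u X ^ 2 + (X * w X) ^ 2) * Real.exp (-(2 * ε * X)) := by
      refine le_trans ?_ h1
      rw [mul_pow, ← Real.exp_nat_mul, show ((2 : ℕ) : ℝ) * -(ε * x) = -(2 * ε * x) by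
        push_cast; ring]
      gcongr
      nlinarith [sq_nonneg (x * w x)]
    have h3 := Real.abs_le_sqrt h2
    rw [abs_mul, abs_of_pos (Real.exp_pos _), Real.exp_neg, ← div_eq_mul_inv,
      div_le_iff₀ (Real.exp_pos _)] at h3
    have h4 := Real.exp_pos (ε * x)
    change |u x| ≤ _
    nlinarith

/-! ### Laplace transforms -/

/-- The Laplace transform at `s` of `x ^ (β - ν) * J_ν x`. -/
noncomputable def besselLaplace (ν β s : ℝ) : ℝ :=
  ∫ x in Ioi (0 : ℝ), x ^ β * besselEntire ν x * Real.exp (-(s * x))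

theorem integrableOn_rpow_mul_exp_neg_mul {β s : ℝ} (hβ : -1 < β) (hs : 0 < s) :
    IntegrableOn (fun x : ℝ => x ^ β * Real.exp (-(s * x))) (Ioi 0) := by
  simpa using integrableOn_rpow_mul_exp_neg_mul_rpow hβ one_pos hs

theorem continuousOn_rpow_mul_besselEntire (ν β s : ℝ) :
    ContinuousOn (fun x : ℝ => x ^ β * besselEntire ν x * Real.exp (-(s * x))) (Ioi 0) := by
  have := continuous_besselEntire ν
  exact ((continuousOn_id.rpow_const fun x hx => Or.inl (ne_of_gt hx)).mul this.continuousOn).mul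
    (by fun_prop)

theorem abs_rpow_mul_besselEntire_le {ν C ε : ℝ}
    (hC : ∀ x : ℝ, 0 ≤ x → |besselEntire ν x| ≤ C * Real.exp (ε * x)) {β s t x : ℝ} (hx : 0 < x)
    (hst : t + ε ≤ s) :
    |x ^ β * besselEntire ν x * Real.exp (-(s * x))| ≤ C * (x ^ β * Real.exp (-(t * x))) := by
  have hβ := Real.rpow_pos_of_pos hx β
  have hC0 : 0 ≤ C := by simpa using (abs_nonneg _).trans (hC 0 le_rfl)
  rw [abs_mul, abs_mul, abs_of_pos hβ, abs_of_pos (Real.exp_pos _)]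
  calc x ^ β * |besselEntire ν x| * Real.exp (-(s * x))
      ≤ x ^ β * (C * Real.exp (ε * x)) * Real.exp (-(s * x)) := by
        gcongr
        exact hC x hx.le
    _ = C * (x ^ β * Real.exp (ε * x + -(s * x))) := by rw [Real.exp_add]; ring
    _ ≤ C * (x ^ β * Real.exp (-(t * x))) := by
        gcongr
        nlinarith

theorem integrableOn_besselLaplace (ν : ℝ) {β s : ℝ} (hβ : -1 < β) (hs : 0 < s) :
    IntegrableOn (fun x : ℝ => x ^ β * besselEntire ν x * Real.exp (-(s * x))) (Ioi 0) := by
  obtain ⟨C, hC⟩ := exists_abs_besselEntire_le ν (half_pos hs)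
  refine ((integrableOn_rpow_mul_exp_neg_mul hβ (half_pos hs)).const_mul C).mono'
    ((continuousOn_rpow_mul_besselEntire ν β s).aestronglyMeasurable measurableSet_Ioi) ?_
  filter_upwards [ae_restrict_mem measurableSet_Ioi] with x hx
  exact abs_rpow_mul_besselEntire_le hC hx (by linarith)

theorem besselLaplace_eq (ν : ℝ) {β s : ℝ} (hβ : -1 < β) (hs : 0 < s) :
    besselLaplace ν β s
      = 2 * (ν + 1) * besselLaplace (ν + 1) β s - besselLaplace (ν + 2) (β + 2) s := by
  simp only [besselLaplace]
  rw [← integral_const_mul, ← integral_sub ((integrableOn_besselLaplace (ν + 1) hβ hs).const_mul _)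
    (integrableOn_besselLaplace (ν + 2) (by linarith) hs)]
  refine setIntegral_congr_fun measurableSet_Ioi fun x hx => ?_
  rw [besselEntire_eq ν x, Real.rpow_add hx, Real.rpow_two]
  ring

theorem besselLaplace_integration_by_parts (ν : ℝ) {β s : ℝ} (hβ : 0 < β) (hs : 0 < s) :
    β * besselLaplace ν (β - 1) s
      = s * besselLaplace ν β s + besselLaplace (ν + 1) (β + 1) s := by
  have i1 := integrableOn_besselLaplace ν (β := β - 1) (by linarith) hs
  have i2 := integrableOn_besselLaplace ν (β := β) (by linarith) hs
  have i3 := integrableOn_besselLaplace (ν + 1) (β := β + 1) (by linarith) hs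
  obtain ⟨C, hC⟩ := exists_abs_besselEntire_le ν (half_pos hs)
  have h := integral_Ioi_of_hasDerivAt_of_tendsto (a := 0) (m := 0)
    (f := fun x : ℝ => x ^ β * besselEntire ν x * Real.exp (-(s * x)))
    (f' := fun x : ℝ => β * (x ^ (β - 1) * besselEntire ν x * Real.exp (-(s * x)))
      - s * (x ^ β * besselEntire ν x * Real.exp (-(s * x)))
      - x ^ (β + 1) * besselEntire (ν + 1) x * Real.exp (-(s * x)))
    (by
      have h1 : Continuous fun x : ℝ => x ^ β := Real.continuous_rpow_const hβ.le
      have h2 := continuous_besselEntire ν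
      exact (h1.mul h2 |>.mul (by fun_prop)).continuousWithinAt)
    (fun x hx => by
      have h1 := ((Real.hasDerivAt_rpow_const (x := x) (p := β) (Or.inl (ne_of_gt hx))).mul
        (hasDerivAt_besselEntire ν x)).mul (((hasDerivAt_id x).const_mul s).neg.exp)
      refine h1.congr_deriv ?_
      rw [Real.rpow_add_one (ne_of_gt hx)]
      simp
      ring)
    (((i1.const_mul β).sub (i2.const_mul s)).sub i3)
    (by
      have h1 := (tendsto_rpow_mul_exp_neg_mul_atTop_nhds_zero β (s / 2) (half_pos hs)).const_mul C
      rw [mul_zero] at h1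
      refine squeeze_zero_norm' ?_ h1
      filter_upwards [eventually_gt_atTop 0] with x hx
      rw [neg_mul]
      exact abs_rpow_mul_besselEntire_le hC hx (by linarith))
  have i4 : IntegrableOn (fun x : ℝ => β * (x ^ (β - 1) * besselEntire ν x * Real.exp (-(s * x)))
      - s * (x ^ β * besselEntire ν x * Real.exp (-(s * x)))) (Ioi 0) :=
    (i1.const_mul β).sub (i2.const_mul s)
  rw [integral_sub i4 i3,
    integral_sub (i1.const_mul β) (i2.const_mul s), integral_const_mul, integral_const_mul,
    Real.zero_rpow hβ.ne'] at h
  simp only [besselLaplace]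
  linarith

/-- Eliminates the order `ν + 2` between the three-term recurrence and integration by parts at order
`ν + 1`. For `β = 2ν + M` the last coefficient is `1 - M`, and relative to order `ν + 1` the two
terms have `M - 1` and `M - 2` in place of `M`. -/
theorem besselLaplace_recurrence (ν : ℝ) {β s : ℝ} (hβ : -1 < β) (hs : 0 < s) :
    besselLaplace ν β s = s * besselLaplace (ν + 1) (β + 1) s
      + (2 * ν + 1 - β) * besselLaplace (ν + 1) β s := by
  have h1 := besselLaplace_eq ν hβ hs
  have h2 := besselLaplace_integration_by_parts (ν + 1) (β := β + 1) (by linarith) hs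
  rw [show β + 1 - 1 = β by ring, show ν + 1 + 1 = ν + 2 by ring,
    show β + 1 + 1 = β + 2 by ring] at h2
  linarith

theorem hasDerivAt_besselLaplace (ν : ℝ) {β s : ℝ} (hβ : -1 < β) (hs : 0 < s) :
    HasDerivAt (besselLaplace ν β) (-besselLaplace ν (β + 1) s) s := by
  -- For `t > s/2`, growth `e^(sx/4)` still leaves decay `e^(-sx/4)`, uniformly in `t`.
  obtain ⟨C, hC⟩ := exists_abs_besselEntire_le ν (ε := s / 4) (by positivity)
  have h := (hasDerivAt_integral_of_dominated_loc_of_deriv_le (𝕜 := ℝ)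
    (μ := volume.restrict (Ioi (0 : ℝ))) (x₀ := s) (s := Ioi (s / 2))
    (F := fun t x => x ^ β * besselEntire ν x * Real.exp (-(t * x)))
    (F' := fun t x => -(x ^ (β + 1) * besselEntire ν x * Real.exp (-(t * x))))
    (bound := fun x => C * (x ^ (β + 1) * Real.exp (-(s / 4 * x))))
    (Ioi_mem_nhds (by linarith))
    (Eventually.of_forall fun t =>
      (continuousOn_rpow_mul_besselEntire ν β t).aestronglyMeasurable measurableSet_Ioi)
    (integrableOn_besselLaplace ν hβ hs)
    ((continuousOn_rpow_mul_besselEntire ν (β + 1) s).aestronglyMeasurable measurableSet_Ioi).neg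
    (by
      filter_upwards [ae_restrict_mem measurableSet_Ioi] with x hx t ht
      rw [norm_neg]
      exact abs_rpow_mul_besselEntire_le hC hx (by rw [mem_Ioi] at ht; linarith))
    ((integrableOn_rpow_mul_exp_neg_mul (by linarith) (by positivity)).const_mul C)
    (by
      filter_upwards [ae_restrict_mem measurableSet_Ioi] with x hx t ht
      have h1 := (((hasDerivAt_id t).mul_const x).neg.exp).const_mul (x ^ β * besselEntire ν x)
      refine h1.congr_deriv ?_
      rw [Real.rpow_add_one (ne_of_gt hx)]
      simp
      ring)).2
  rw [integral_neg] at h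
  exact h

/-- The Laplace transform of `x ^ ν * J_ν x` is a multiple of `(1 + s ^ 2) ^ (-ν - 1 / 2)`. -/
theorem exists_besselLaplace_mul_eq {ν : ℝ} (hν : -1 < 2 * ν) :
    ∃ K : ℝ, ∀ s : ℝ, 0 < s →
      besselLaplace ν (2 * ν) s * (1 + s ^ 2) ^ (ν + 1 / 2) = K := by
  have hd : ∀ s : ℝ, 0 < s → HasDerivAt
      (fun s => besselLaplace ν (2 * ν) s * (1 + s ^ 2) ^ (ν + 1 / 2)) 0 s := by
    intro s hs
    have hpos : 0 < 1 + s ^ 2 := by positivity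
    have h1 := (hasDerivAt_besselLaplace ν hν hs).mul
      (((hasDerivAt_pow 2 s).const_add 1).rpow_const (p := ν + 1 / 2) (Or.inl hpos.ne'))
    refine h1.congr_deriv ?_
    have h2 := besselLaplace_recurrence ν (β := 2 * ν + 1) (by linarith) hs
    have h3 := besselLaplace_integration_by_parts ν (β := 2 * ν + 1) (by linarith) hs
    rw [show 2 * ν + 1 - 1 = 2 * ν by ring] at h3
    -- This is the differential equation `(1 + s²) L' = -(2ν+1) s L`.
    have h4 : (1 + s ^ 2) * besselLaplace ν (2 * ν + 1) s
        = s * ((2 * ν + 1) * besselLaplace ν (2 * ν) s) := by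
      rw [h3]
      linear_combination h2
    have h5 : (1 + s ^ 2) ^ (ν + 1 / 2) = (1 + s ^ 2) ^ (ν + 1 / 2 - 1) * (1 + s ^ 2) := by
      rw [← Real.rpow_add_one hpos.ne']
      ring_nf
    rw [h5]
    push_cast
    linear_combination -(1 + s ^ 2) ^ (ν + 1 / 2 - 1) * h4
  refine ⟨besselLaplace ν (2 * ν) 1 * (1 + 1 ^ 2) ^ (ν + 1 / 2), fun s hs => ?_⟩
  exact (convex_Ioi (0 : ℝ)).is_const_of_fderivWithin_eq_zero (𝕜 := ℝ)
    (fun x hx => (hd x hx).differentiableAt.differentiableWithinAt)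
    (fun x hx => by
      rw [fderivWithin_of_isOpen isOpen_Ioi hx]
      simpa using (hd x hx).hasFDerivAt.fderiv) hs (mem_Ioi.2 one_pos)

/-- Leading order of Watson's lemma: after rescaling `x` by `s⁻¹`, the entire factor tends to its
value at 0 and a Gamma integral remains. -/
theorem tendsto_besselLaplace_mul_rpow_atTop (ν : ℝ) {β : ℝ} (hβ : -1 < β) :
    Tendsto (fun s => besselLaplace ν β s * s ^ (β + 1)) atTop
      (𝓝 (Real.Gamma (β + 1) * besselEntire ν 0)) := by
  obtain ⟨C, hC⟩ := exists_abs_besselEntire_le ν (ε := 1 / 2) (by positivity)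
  have hC0 : 0 ≤ C := by simpa using (abs_nonneg _).trans (hC 0 le_rfl)
  have hcont := continuous_besselEntire ν
  have hlim := tendsto_integral_filter_of_dominated_convergence
    (μ := volume.restrict (Ioi (0 : ℝ))) (l := atTop)
    (F := fun (s : ℝ) (x : ℝ) => x ^ β * besselEntire ν (s⁻¹ * x) * Real.exp (-(1 * x)))
    (f := fun x => x ^ β * besselEntire ν 0 * Real.exp (-(1 * x)))
    (bound := fun x => C * (x ^ β * Real.exp (-(1 / 2 * x))))
    (Eventually.of_forall fun s => ContinuousOn.aestronglyMeasurable
      (((continuousOn_id.rpow_const fun x hx => Or.inl (ne_of_gt hx)).mul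
        (by fun_prop)).mul (by fun_prop)) measurableSet_Ioi)
    (by
      filter_upwards [eventually_ge_atTop 1] with s hs
      filter_upwards [ae_restrict_mem measurableSet_Ioi] with x hx
      have hx' : 0 < x := hx
      have hxs : 0 ≤ s⁻¹ * x := by positivity
      have hle : s⁻¹ * x ≤ x := mul_le_of_le_one_left hx'.le (inv_le_one_of_one_le₀ hs)
      have h1 : |besselEntire ν (s⁻¹ * x)| ≤ C * Real.exp (1 / 2 * x) :=
        (hC _ hxs).trans (by gcongr)
      rw [Real.norm_eq_abs, abs_mul, abs_mul, abs_of_pos (Real.rpow_pos_of_pos hx' β),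
        abs_of_pos (Real.exp_pos _)]
      calc x ^ β * |besselEntire ν (s⁻¹ * x)| * Real.exp (-(1 * x))
          ≤ x ^ β * (C * Real.exp (1 / 2 * x)) * Real.exp (-(1 * x)) := by gcongr
        _ = C * (x ^ β * Real.exp (1 / 2 * x + -(1 * x))) := by rw [Real.exp_add]; ring
        _ = C * (x ^ β * Real.exp (-(1 / 2 * x))) := by ring_nf)
    ((integrableOn_rpow_mul_exp_neg_mul hβ (by positivity)).const_mul C)
    (Eventually.of_forall fun x => by
      have h1 : Tendsto (fun s : ℝ => s⁻¹ * x) atTop (𝓝 0) := by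
        simpa using tendsto_inv_atTop_zero.mul_const x
      exact (((hcont.tendsto 0).comp h1).const_mul _).mul_const _)
  have hval : ∫ x in Ioi (0 : ℝ), x ^ β * besselEntire ν 0 * Real.exp (-(1 * x))
      = Real.Gamma (β + 1) * besselEntire ν 0 := by
    have h := Real.integral_rpow_mul_exp_neg_mul_Ioi (a := β + 1) (r := 1) (by linarith) one_pos
    rw [div_one, Real.one_rpow, one_mul, add_sub_cancel_right] at h
    rw [← h, ← integral_mul_const]
    congr 1
    funext x
    ring
  rw [hval] at hlim
  refine hlim.congr' ?_
  filter_upwards [eventually_gt_atTop 0] with s hs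
  have h := integral_comp_mul_left_Ioi
    (fun x => x ^ β * besselEntire ν (s⁻¹ * x) * Real.exp (-(1 * x))) 0 hs
  rw [mul_zero, smul_eq_mul, eq_inv_mul_iff_mul_eq₀ hs.ne'] at h
  rw [← h, besselLaplace, ← integral_const_mul, ← integral_mul_const]
  refine setIntegral_congr_fun measurableSet_Ioi fun x hx => ?_
  rw [inv_mul_cancel_left₀ hs.ne', Real.mul_rpow hs.le (le_of_lt hx), Real.rpow_add_one hs.ne',
    one_mul]
  ring

/-- The constant `K` is read off at `s → ∞` and simplified by the duplication formula; the closed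
form then gives the limit at `s → 0`. -/
theorem tendsto_besselLaplace_two_mul {ν : ℝ} (hν : -1 < 2 * ν) :
    Tendsto (besselLaplace ν (2 * ν)) (𝓝[>] 0)
      (𝓝 (2 ^ ν / Real.sqrt Real.pi * Real.Gamma (ν + 1 / 2))) := by
  obtain ⟨K, hK⟩ := exists_besselLaplace_mul_eq hν
  have hKval : K = 2 ^ ν / Real.sqrt Real.pi * Real.Gamma (ν + 1 / 2) := by
    have h1 := tendsto_besselLaplace_mul_rpow_atTop ν hν
    have h2 : Tendsto (fun s : ℝ => (1 + (s⁻¹) ^ 2) ^ (ν + 1 / 2)) atTop (𝓝 1) := by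
      have h3 : Tendsto (fun s : ℝ => 1 + (s⁻¹) ^ 2) atTop (𝓝 1) := by
        simpa using (tendsto_inv_atTop_zero (𝕜 := ℝ)).pow 2 |>.const_add 1
      simpa using h3.rpow_const (p := ν + 1 / 2) (Or.inl one_ne_zero)
    have h4 := h1.mul h2
    rw [mul_one] at h4
    have h5 : Tendsto (fun _ : ℝ => K) atTop (𝓝 (Real.Gamma (2 * ν + 1) * besselEntire ν 0)) := by
      refine h4.congr' ?_
      filter_upwards [eventually_gt_atTop 0] with s hs
      rw [← hK s hs, mul_assoc]
      congr 1
      rw [show 2 * ν + 1 = 2 * (ν + 1 / 2) by ring, Real.rpow_mul hs.le, Real.rpow_two,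
        ← Real.mul_rpow (by positivity) (by positivity)]
      congr 1
      field_simp
      ring
    have h6 := tendsto_nhds_unique tendsto_const_nhds h5
    have h7 := Real.Gamma_mul_Gamma_add_half (ν + 1 / 2)
    rw [show ν + 1 / 2 + 1 / 2 = ν + 1 by ring, show 2 * (ν + 1 / 2) = 2 * ν + 1 by ring,
      show 1 - (2 * ν + 1) = -ν + -ν by ring, Real.rpow_add (by norm_num),
      Real.rpow_neg (by norm_num)] at h7
    have h8 : Real.Gamma (ν + 1) ≠ 0 := (Real.Gamma_pos_of_pos (by linarith)).ne'
    have h9 : Real.sqrt Real.pi ≠ 0 := (Real.sqrt_pos.2 Real.pi_pos).ne'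
    rw [h6, besselEntire_zero, Real.rpow_neg (by norm_num)]
    field_simp
    field_simp at h7
    rw [mul_comm ν 2] at h7
    linear_combination -h7
  have h1 : Tendsto (fun s : ℝ => K * (1 + s ^ 2) ^ (-(ν + 1 / 2))) (𝓝[>] 0) (𝓝 K) := by
    have h2 : Tendsto (fun s : ℝ => 1 + s ^ 2) (𝓝[>] 0) (𝓝 1) := by
      have : Continuous fun s : ℝ => 1 + s ^ 2 := by fun_prop
      simpa using (this.tendsto 0).mono_left nhdsWithin_le_nhds
    simpa using (h2.rpow_const (p := -(ν + 1 / 2)) (Or.inl one_ne_zero)).const_mul K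
  rw [← hKval]
  refine h1.congr' ?_
  filter_upwards [self_mem_nhdsWithin] with s hs
  have hpos : 0 < 1 + s ^ 2 := by positivity
  rw [← hK s hs, mul_assoc, ← Real.rpow_add hpos, add_neg_cancel, Real.rpow_zero, mul_one]

/-- The Abel moment `∫ x ^ (ν + M) J_ν x dx`. -/
noncomputable def besselMoment (ν : ℝ) (M : ℕ) : ℝ :=
  if Even M then (-4) ^ (M / 2) * 2 ^ ν / Real.pi * Real.Gamma (ν + (M / 2 : ℕ) + 1 / 2)
    * Real.Gamma ((M / 2 : ℕ) + 1 / 2) else 0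

theorem besselMoment_add_two (ν : ℝ) (M : ℕ) :
    besselMoment ν (M + 2) = -(M + 1) * besselMoment (ν + 1) M := by
  rw [besselMoment, besselMoment]
  by_cases h : Even M
  · obtain ⟨N, rfl⟩ := h
    rw [if_pos (by simp [parity_simps]), if_pos (by simp), show (N + N + 2) / 2 = N + 1 by omega,
      show (N + N) / 2 = N by omega]
    push_cast
    rw [show (N : ℝ) + 1 + 1 / 2 = N + 1 / 2 + 1 by ring, Real.Gamma_add_one (by positivity),
      Real.rpow_add_one (by norm_num), show ν + ((N : ℝ) + 1) + 1 / 2 = ν + 1 + N + 1 / 2 by ring]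
    ring
  · rw [if_neg (by simpa [parity_simps] using h), if_neg h, mul_zero]

/-- As `s → 0` in `besselLaplace_recurrence`, the term with factor `s` vanishes because its
transform converges, leaving `-(M-1)` times the moment with `ν + 1`, `M - 2`. The induction
therefore runs over all `ν` at once. -/
theorem tendsto_besselLaplace (M : ℕ) : ∀ ν : ℝ, -1 < 2 * ν + M →
    Tendsto (besselLaplace ν (2 * ν + M)) (𝓝[>] 0) (𝓝 (besselMoment ν M)) := by
  have hid : Tendsto (fun s : ℝ => s) (𝓝[>] 0) (𝓝 0) := tendsto_id.mono_left nhdsWithin_le_nhds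
  induction M using Nat.strong_induction_on with
  | _ M ih =>
    intro ν hν
    match M with
    | 0 =>
      rw [Nat.cast_zero, add_zero] at *
      convert tendsto_besselLaplace_two_mul hν using 2
      rw [besselMoment]
      simp only [Even.zero, if_true, Nat.zero_div, pow_zero, Nat.cast_zero, add_zero, zero_add,
        one_mul, Real.Gamma_one_half_eq]
      nth_rewrite 1 [← Real.sq_sqrt Real.pi_pos.le]
      have : Real.sqrt Real.pi ≠ 0 := (Real.sqrt_pos.2 Real.pi_pos).ne'
      field_simp
    | 1 =>
      -- For `M = 1` the coefficient `2ν + 1 - β` is zero, so only the term with factor `s` remains.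
      have h := hid.mul (ih 0 one_pos (ν + 1) (by push_cast at *; linarith))
      rw [zero_mul] at h
      have h0 : besselMoment ν 1 = 0 := if_neg (by decide)
      rw [h0]
      refine h.congr' ?_
      filter_upwards [self_mem_nhdsWithin] with s hs
      rw [besselLaplace_recurrence ν hν hs]
      push_cast
      ring_nf
    | M + 2 =>
      push_cast at hν
      have h1 := hid.mul (ih (M + 1) (by omega) (ν + 1) (by push_cast; linarith))
      have h2 := (ih M (by omega) (ν + 1) (by linarith)).const_mul (-((M : ℝ) + 1))
      have h := h1.add h2
      rw [zero_mul, zero_add, ← besselMoment_add_two] at h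
      refine h.congr' ?_
      filter_upwards [self_mem_nhdsWithin] with s hs
      push_cast
      rw [besselLaplace_recurrence ν hν hs]
      ring_nf

/-! ### Orthogonality with respect to a moment functional -/

/-- The linear functional on polynomials with `X ^ j ↦ c j`. -/
noncomputable def momentFunctional (c : ℕ → ℂ) : Polynomial ℂ →ₗ[ℂ] ℂ :=
  Polynomial.lsum fun j => LinearMap.toSpanSingleton ℂ ℂ (c j)

theorem momentFunctional_apply (c : ℕ → ℂ) (p : Polynomial ℂ) :
    momentFunctional c p = ∑ j ∈ p.support, p.coeff j * c j := by
  simp [momentFunctional, Polynomial.lsum_apply, Polynomial.sum_def]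

@[simp]
theorem momentFunctional_monomial (c : ℕ → ℂ) (j : ℕ) (a : ℂ) :
    momentFunctional c (Polynomial.monomial j a) = a * c j := by
  simp [momentFunctional, Polynomial.lsum_apply, Polynomial.sum_monomial_index]

theorem momentFunctional_mul_X_pow (c : ℕ → ℂ) (p : Polynomial ℂ) (k : ℕ) :
    momentFunctional c (p * Polynomial.X ^ k) = momentFunctional (fun j => c (j + k)) p := by
  induction p using Polynomial.induction_on' with
  | add p q hp hq => rw [add_mul, map_add, map_add, hp, hq]
  | monomial n a => rw [Polynomial.monomial_mul_X_pow, momentFunctional_monomial,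
      momentFunctional_monomial]

theorem momentFunctional_expand (c : ℕ → ℂ) (p : Polynomial ℂ) :
    momentFunctional c (Polynomial.expand ℂ 2 p) = momentFunctional (fun l => c (2 * l)) p := by
  induction p using Polynomial.induction_on' with
  | add p q hp hq => rw [map_add, map_add, map_add, hp, hq]
  | monomial n a => rw [Polynomial.expand_monomial, momentFunctional_monomial,
      momentFunctional_monomial, mul_comm n]

theorem momentFunctional_X_mul_expand (c : ℕ → ℂ) (p : Polynomial ℂ) :
    momentFunctional c (Polynomial.X * Polynomial.expand ℂ 2 p)
      = momentFunctional (fun l => c (2 * l + 1)) p := by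
  have h := momentFunctional_mul_X_pow c (Polynomial.expand ℂ 2 p) 1
  rw [pow_one, momentFunctional_expand] at h
  rw [mul_comm, h]

theorem momentFunctional_const_mul (κ : ℂ) (c : ℕ → ℂ) (p : Polynomial ℂ) :
    momentFunctional (fun j => κ * c j) p = κ * momentFunctional c p := by
  rw [momentFunctional_apply, momentFunctional_apply, Finset.mul_sum]
  exact Finset.sum_congr rfl fun j _ => by ring

/-- `p` is monic of degree `n` and annihilated by `Λ` after multiplication by `1, …, X ^ (n-1)`. -/
def IsMonicOrthogonal (Λ : Polynomial ℂ →ₗ[ℂ] ℂ) (n : ℕ) (p : Polynomial ℂ) : Prop :=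
  p.Monic ∧ p.natDegree = n ∧ ∀ k < n, Λ (p * Polynomial.X ^ k) = 0

/-- As `μ + ν = 2ν + m`, the coefficient of `X ^ j` contributes the moment with `M = m + j + k`; the
bound on `μ + ν` is integrability at 0. -/
theorem hasAbelIntegral_eval_mul_besselJ {μ ν : ℝ} (hμν : -1 < μ + ν) {m : ℕ}
    (hm : μ - ν = m) (p : Polynomial ℂ) (k : ℕ) :
    HasAbelIntegral
      (fun x : ℝ => p.eval (x : ℂ) * ((x ^ ((k : ℝ) + μ) * besselJ ν x : ℝ) : ℂ))
      (momentFunctional (fun j => (besselMoment ν (m + j) : ℂ)) (p * Polynomial.X ^ k)) := by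
  have hexp : ∀ j : ℕ, -1 < 2 * ν + ((m + (j + k) : ℕ) : ℝ) := by
    intro j
    have h1 : (0 : ℝ) ≤ j := j.cast_nonneg
    have h2 : (0 : ℝ) ≤ k := k.cast_nonneg
    push_cast
    linarith
  have hpt : ∀ s : ℝ, EqOn
      (fun x : ℝ => ∑ j ∈ p.support, p.coeff j *
        ((x ^ (2 * ν + ((m + (j + k) : ℕ) : ℝ)) * besselEntire ν x * Real.exp (-(s * x)) : ℝ) : ℂ))
      (fun x : ℝ => p.eval (x : ℂ) * ((x ^ ((k : ℝ) + μ) * besselJ ν x : ℝ) : ℂ)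
        * (Real.exp (-(s * x)) : ℂ)) (Ioi 0) := by
    intro s x hx
    have hx' : 0 < x := hx
    simp only
    rw [Polynomial.eval_eq_sum, Polynomial.sum_def, Finset.sum_mul, Finset.sum_mul]
    refine Finset.sum_congr rfl fun j _ => ?_
    rw [besselJ_eq_rpow_mul_besselEntire ν hx',
      show 2 * ν + ((m + (j + k) : ℕ) : ℝ) = j + (k + μ) + ν by push_cast; linarith,
      Real.rpow_add hx', Real.rpow_add hx' j, Real.rpow_natCast]
    push_cast
    ring
  have hint : ∀ s : ℝ, 0 < s → ∀ j ∈ p.support, IntegrableOn (fun x : ℝ => p.coeff j *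
      ((x ^ (2 * ν + ((m + (j + k) : ℕ) : ℝ)) * besselEntire ν x * Real.exp (-(s * x)) : ℝ) : ℂ))
      (Ioi 0) := fun s hs j _ =>
    (integrableOn_besselLaplace ν (hexp j) hs).ofReal.const_mul _
  refine ⟨fun s hs => IntegrableOn.congr_fun
    (integrable_finsetSum _ (hint s hs)) (hpt s) measurableSet_Ioi, ?_⟩
  rw [momentFunctional_mul_X_pow, momentFunctional_apply]
  have hlim := tendsto_finsetSum p.support fun j _ =>
    ((Complex.continuous_ofReal.tendsto _).comp
      (tendsto_besselLaplace (m + (j + k)) ν (hexp j))).const_mul (p.coeff j)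
  refine hlim.congr' ?_
  filter_upwards [self_mem_nhdsWithin] with s hs
  rw [← setIntegral_congr_fun measurableSet_Ioi (hpt s), integral_finsetSum _ (hint s hs)]
  refine Finset.sum_congr rfl fun j _ => ?_
  rw [integral_const_mul, integral_complex_ofReal]
  rfl

theorem HasAbelIntegral.unique {f : ℝ → ℂ} {L L' : ℂ} (h : HasAbelIntegral f L)
    (h' : HasAbelIntegral f L') : L = L' :=
  tendsto_nhds_unique h.2 h'.2

theorem isBesselOrthogonal_iff {μ ν : ℝ} (hμν : -1 < μ + ν) {m : ℕ} (hm : μ - ν = m) (n : ℕ)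
    (p : Polynomial ℂ) :
    IsBesselOrthogonal μ ν n p ↔
      IsMonicOrthogonal (momentFunctional fun j => (besselMoment ν (m + j) : ℂ)) n p := by
  refine and_congr_right fun _ => and_congr_right fun _ => forall₂_congr fun k _ => ?_
  have h := hasAbelIntegral_eval_mul_besselJ hμν hm p k
  exact ⟨fun h0 => h.unique h0, fun h0 => h0 ▸ h⟩

/-! ### Functionals positive on the negative half-axis -/

/-- The functional `Λ` is positive definite and represented by a measure on `(-∞, 0]`, as far as
this is visible on the polynomials `q * conj q` and `X * q * conj q`. -/
structure IsPositiveOnNegAxis (Λ : Polynomial ℂ →ₗ[ℂ] ℂ) : Prop where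
  pos : ∀ q : Polynomial ℂ, q ≠ 0 →
    ∃ r : ℝ, 0 < r ∧ Λ (q * q.map (starRingEnd ℂ)) = r
  nonpos : ∀ q : Polynomial ℂ,
    ∃ r : ℝ, r ≤ 0 ∧ Λ (Polynomial.X * (q * q.map (starRingEnd ℂ))) = r

theorem map_mul_eq_zero_of_degree_lt {Λ : Polynomial ℂ →ₗ[ℂ] ℂ} {n : ℕ} {p q : Polynomial ℂ}
    (hp : ∀ k < n, Λ (p * Polynomial.X ^ k) = 0) (hq : q.degree < n) : Λ (p * q) = 0 := by
  rw [q.as_sum_support_C_mul_X_pow, Finset.mul_sum, map_sum]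
  refine Finset.sum_eq_zero fun k hk => ?_
  have hkn : k < n := by
    by_contra! h
    exact Polynomial.mem_support_iff.1 hk ((Polynomial.degree_lt_iff_coeff_zero q n).1 hq k h)
  rw [mul_left_comm, ← Polynomial.smul_eq_C_mul, map_smul, hp k hkn, smul_zero]

theorem degree_map_starRingEnd (q : Polynomial ℂ) :
    (q.map (starRingEnd ℂ)).degree = q.degree :=
  Polynomial.degree_map_eq_of_injective (starRingEnd ℂ).injective q

namespace IsPositiveOnNegAxis

variable {Λ : Polynomial ℂ →ₗ[ℂ] ℂ}

/-- `p` may be tested against its own conjugate, which contradicts positivity unless `p = 0`. -/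
theorem eq_zero (hΛ : IsPositiveOnNegAxis Λ) {n : ℕ} {p : Polynomial ℂ} (hd : p.degree < n)
    (hp : ∀ k < n, Λ (p * Polynomial.X ^ k) = 0) : p = 0 := by
  by_contra h
  obtain ⟨r, hr, hr'⟩ := hΛ.pos p h
  rw [map_mul_eq_zero_of_degree_lt hp (by rwa [degree_map_starRingEnd])] at hr'
  exact hr.ne (by exact_mod_cast hr')

/-- The lower coefficients solve a square linear system, injective by `eq_zero` and hence
surjective. -/
theorem existsUnique (hΛ : IsPositiveOnNegAxis Λ) (n : ℕ) :
    ∃! p : Polynomial ℂ, IsMonicOrthogonal Λ n p := by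
  let T : Polynomial.degreeLT ℂ n →ₗ[ℂ] (Fin n → ℂ) :=
    LinearMap.pi fun k => Λ ∘ₗ (LinearMap.mulRight ℂ (Polynomial.X ^ (k : ℕ))) ∘ₗ
      (Polynomial.degreeLT ℂ n).subtype
  have hT : ∀ q k, T q k = Λ ((q : Polynomial ℂ) * Polynomial.X ^ (k : ℕ)) := fun q k => rfl
  have hinj : Function.Injective T := by
    rw [← LinearMap.ker_eq_bot, LinearMap.ker_eq_bot']
    intro q hq
    refine Subtype.ext (hΛ.eq_zero (Polynomial.mem_degreeLT.1 q.2) fun k hk => ?_)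
    rw [← hT q ⟨k, hk⟩, hq]
    rfl
  have hsurj : Function.Surjective T := by
    let e := Polynomial.degreeLTEquiv ℂ n
    have : Function.Injective (T ∘ₗ e.symm.toLinearMap) := hinj.comp e.symm.injective
    have h := LinearMap.injective_iff_surjective.1 this
    exact Function.Surjective.of_comp h
  obtain ⟨q, hq⟩ := hsurj fun k => -Λ (Polynomial.X ^ n * Polynomial.X ^ (k : ℕ))
  have hqd := Polynomial.mem_degreeLT.1 q.2
  refine ⟨Polynomial.X ^ n + (q : Polynomial ℂ), ⟨Polynomial.monic_X_pow_add hqd, ?_, fun k hk => ?_⟩, ?_⟩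
  · exact Polynomial.natDegree_eq_of_degree_eq_some
      (by rw [Polynomial.degree_add_eq_left_of_degree_lt] <;> simp [hqd])
  · rw [add_mul, map_add, ← hT q ⟨k, hk⟩, hq, add_neg_cancel]
  · rintro p ⟨hm, hd, hp⟩
    have hpd : p.degree = n := by rw [Polynomial.degree_eq_natDegree hm.ne_zero, hd]
    have h1 : (p - (Polynomial.X ^ n + (q : Polynomial ℂ))).degree < (n : WithBot ℕ) := by
      rw [← hpd]
      refine Polynomial.degree_sub_lt_left ?_ hm.ne_zero ?_
      · rw [hpd, Polynomial.degree_add_eq_left_of_degree_lt] <;> simp [hqd]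
      · rw [hm.leadingCoeff, (Polynomial.monic_X_pow_add hqd).leadingCoeff]
    refine sub_eq_zero.1 (hΛ.eq_zero h1 fun k hk => ?_)
    rw [sub_mul, map_sub, hp k hk, add_mul, map_add, ← hT q ⟨k, hk⟩, hq, add_neg_cancel, sub_zero]

/-- With `p = (X - z) q`, testing against `conj q` gives `z = Λ(X q conj q) / Λ(q conj q)`. -/
theorem exists_ofReal_of_isRoot (hΛ : IsPositiveOnNegAxis Λ) {n : ℕ} {p : Polynomial ℂ}
    (hp : IsMonicOrthogonal Λ n p) {z : ℂ} (hz : p.IsRoot z) : ∃ t : ℝ, t ≤ 0 ∧ z = t := by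
  obtain ⟨hm, hd, ho⟩ := hp
  obtain ⟨q, rfl⟩ := Polynomial.dvd_iff_isRoot.2 hz
  have hq : q ≠ 0 := right_ne_zero_of_mul hm.ne_zero
  have hqd : q.degree < n := by
    rw [← hd, ← Polynomial.degree_eq_natDegree hm.ne_zero, Polynomial.degree_mul,
      Polynomial.degree_X_sub_C, Polynomial.degree_eq_natDegree hq]
    exact_mod_cast Nat.lt_one_add_iff.2 le_rfl
  obtain ⟨r, hr, hr'⟩ := hΛ.pos q hq
  obtain ⟨t, ht, ht'⟩ := hΛ.nonpos q
  have h := map_mul_eq_zero_of_degree_lt ho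
    (q := q.map (starRingEnd ℂ)) (by rwa [degree_map_starRingEnd])
  rw [mul_assoc, sub_mul, map_sub, ht', ← Polynomial.smul_eq_C_mul, map_smul, hr', smul_eq_mul,
    sub_eq_zero] at h
  refine ⟨t / r, div_nonpos_of_nonpos_of_nonneg ht hr.le, ?_⟩
  have : (r : ℂ) ≠ 0 := by exact_mod_cast hr.ne'
  push_cast
  rw [h, mul_div_cancel_right₀ _ this]

end IsPositiveOnNegAxis

/-! ### Moments that are products of two Gamma values -/

/-- The functional with moments `(-4)^l Γ(a + l) Γ(b + l)`. -/
noncomputable def gammaFunctional (a b : ℝ) : Polynomial ℂ →ₗ[ℂ] ℂ :=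
  momentFunctional fun l => (((-4) ^ l * Real.Gamma (a + l) * Real.Gamma (b + l) : ℝ) : ℂ)

/-- The density of a product of two Gamma distributions, up to normalization. -/
noncomputable def gammaWeight (a b : ℝ) (z : ℝ × ℝ) : ℝ :=
  Real.exp (-z.1) * z.1 ^ (a - 1) * (Real.exp (-z.2) * z.2 ^ (b - 1))

/-- Integrating over the quadrant rather than against a density on the half-line makes each moment
factor into two Gamma integrals. -/
theorem hasIntegral_gammaFunctional {a b : ℝ} (ha : 0 < a) (hb : 0 < b) (p : Polynomial ℂ) :
    IntegrableOn (fun z : ℝ × ℝ => p.eval ((-4 * z.1 * z.2 : ℝ) : ℂ) * (gammaWeight a b z : ℂ))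
        (Ioi 0 ×ˢ Ioi 0) ∧
      ∫ z in Ioi (0 : ℝ) ×ˢ Ioi (0 : ℝ),
        p.eval ((-4 * z.1 * z.2 : ℝ) : ℂ) * (gammaWeight a b z : ℂ) = gammaFunctional a b p := by
  have hpt : ∀ l : ℕ, EqOn
      (fun z : ℝ × ℝ => (((-4) ^ l * (Real.exp (-z.1) * z.1 ^ (a + l - 1)
        * (Real.exp (-z.2) * z.2 ^ (b + l - 1))) : ℝ) : ℂ))
      (fun z => ((-4 * z.1 * z.2 : ℝ) : ℂ) ^ l * (gammaWeight a b z : ℂ)) (Ioi 0 ×ˢ Ioi 0) := by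
    rintro l ⟨x, y⟩ ⟨hx, hy⟩
    simp only [mem_Ioi] at hx hy
    simp only [gammaWeight]
    rw [show a + l - 1 = a - 1 + l by ring, show b + l - 1 = b - 1 + l by ring,
      Real.rpow_add_natCast hx.ne', Real.rpow_add_natCast hy.ne']
    push_cast
    ring
  have hint : ∀ l : ℕ, IntegrableOn (fun z : ℝ × ℝ => (-4 : ℝ) ^ l * (Real.exp (-z.1)
      * z.1 ^ (a + l - 1) * (Real.exp (-z.2) * z.2 ^ (b + l - 1)))) (Ioi 0 ×ˢ Ioi 0) := by
    intro l
    rw [IntegrableOn, Measure.volume_eq_prod, ← Measure.prod_restrict]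
    exact ((Real.GammaIntegral_convergent (s := a + l) (by positivity)).mul_prod
      (Real.GammaIntegral_convergent (s := b + l) (by positivity))).const_mul _
  have hint' : ∀ l : ℕ, IntegrableOn (fun z : ℝ × ℝ =>
      ((-4 * z.1 * z.2 : ℝ) : ℂ) ^ l * (gammaWeight a b z : ℂ)) (Ioi 0 ×ˢ Ioi 0) := fun l =>
    IntegrableOn.congr_fun (hint l).ofReal (hpt l) (measurableSet_Ioi.prod measurableSet_Ioi)
  have hval : ∀ l : ℕ, ∫ z in Ioi (0 : ℝ) ×ˢ Ioi (0 : ℝ),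
      ((-4 * z.1 * z.2 : ℝ) : ℂ) ^ l * (gammaWeight a b z : ℂ)
        = (((-4) ^ l * Real.Gamma (a + l) * Real.Gamma (b + l) : ℝ) : ℂ) := by
    intro l
    rw [← setIntegral_congr_fun (measurableSet_Ioi.prod measurableSet_Ioi) (hpt l),
      integral_complex_ofReal, integral_const_mul, Measure.volume_eq_prod,
      ← Measure.prod_restrict,
      integral_prod_mul (fun x : ℝ => Real.exp (-x) * x ^ (a + l - 1))
        (fun y : ℝ => Real.exp (-y) * y ^ (b + l - 1)),
      ← Real.Gamma_eq_integral (by positivity), ← Real.Gamma_eq_integral (by positivity),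
      mul_assoc]
  have hsum : (fun z : ℝ × ℝ => p.eval ((-4 * z.1 * z.2 : ℝ) : ℂ) * (gammaWeight a b z : ℂ))
      = fun z => ∑ l ∈ p.support, p.coeff l *
        (((-4 * z.1 * z.2 : ℝ) : ℂ) ^ l * (gammaWeight a b z : ℂ)) := by
    funext z
    rw [Polynomial.eval_eq_sum, Polynomial.sum_def, Finset.sum_mul]
    exact Finset.sum_congr rfl fun l _ => by ring
  rw [hsum]
  refine ⟨integrable_finsetSum _ fun l _ => (hint' l).const_mul _, ?_⟩
  rw [integral_finsetSum _ fun l _ => (hint' l).const_mul _, gammaFunctional,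
    momentFunctional_apply]
  exact Finset.sum_congr rfl fun l _ => by rw [integral_const_mul, hval]

theorem isPositiveOnNegAxis_gammaFunctional {a b : ℝ} (ha : 0 < a) (hb : 0 < b) :
    IsPositiveOnNegAxis (gammaFunctional a b) := by
  have hS : MeasurableSet (Ioi (0 : ℝ) ×ˢ Ioi (0 : ℝ)) := measurableSet_Ioi.prod measurableSet_Ioi
  have hw : ∀ z ∈ Ioi (0 : ℝ) ×ˢ Ioi (0 : ℝ), 0 < gammaWeight a b z := by
    rintro ⟨x, y⟩ ⟨hx, hy⟩
    simp only [mem_Ioi] at hx hy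
    have h1 := Real.rpow_pos_of_pos hx (a - 1)
    have h2 := Real.rpow_pos_of_pos hy (b - 1)
    rw [gammaWeight]
    positivity
  have heval : ∀ (q : Polynomial ℂ) (t : ℝ),
      (q * q.map (starRingEnd ℂ)).eval (t : ℂ) = (Complex.normSq (q.eval (t : ℂ)) : ℂ) := by
    intro q t
    rw [Polynomial.eval_mul, ← Complex.mul_conj, ← Polynomial.eval_map_apply, Complex.conj_ofReal]
  refine ⟨fun q hq => ?_, fun q => ?_⟩
  · obtain ⟨hi, hv⟩ := hasIntegral_gammaFunctional ha hb (q * q.map (starRingEnd ℂ))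
    simp only [heval, ← Complex.ofReal_mul] at hi hv
    rw [integral_complex_ofReal] at hv
    refine ⟨_, ?_, hv.symm⟩
    have hi' := hi.re
    simp only [RCLike.re_eq_complex_re, Complex.ofReal_re] at hi'
    rw [setIntegral_pos_iff_support_of_nonneg_ae ((ae_restrict_mem hS).mono fun z hz =>
      mul_nonneg (Complex.normSq_nonneg _) (hw z hz).le) hi']
    set U : Set (ℝ × ℝ) := {z | q.eval ((-4 * z.1 * z.2 : ℝ) : ℂ) ≠ 0}
    have hU : IsOpen U := by
      refine isOpen_ne_fun ?_ continuous_const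
      exact q.continuous.comp (Complex.continuous_ofReal.comp (by fun_prop))
    -- Otherwise every `-4x` with `x > 0` is a root of `q` (take `y = 1`).
    have hne : ((Ioi (0 : ℝ) ×ˢ Ioi (0 : ℝ)) ∩ U).Nonempty := by
      by_contra! hempty
      have hroot : ∀ x : ℝ, 0 < x → q.IsRoot ((-4 * x : ℝ) : ℂ) := by
        intro x hx
        by_contra hx'
        have : ((x, 1) : ℝ × ℝ) ∈ (Ioi (0 : ℝ) ×ˢ Ioi (0 : ℝ)) ∩ U := by
          refine ⟨⟨hx, mem_Ioi.2 one_pos⟩, ?_⟩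
          simpa [U] using hx'
        rw [hempty] at this
        exact this
      refine hq (Polynomial.eq_zero_of_infinite_isRoot q ?_)
      refine ((Ioi_infinite (0 : ℝ)).image (f := fun x : ℝ => ((-4 * x : ℝ) : ℂ)) ?_).mono ?_
      · intro x _ y _ hxy
        have : (-4 * x : ℝ) = -4 * y := Complex.ofReal_injective hxy
        linarith
      · rintro _ ⟨x, hx, rfl⟩
        exact hroot x hx
    refine (((isOpen_Ioi.prod isOpen_Ioi).inter hU).measure_pos volume hne).trans_le
      (measure_mono ?_)
    rintro z ⟨hz, hzU⟩
    exact ⟨mul_ne_zero (Complex.normSq_pos.2 hzU).ne' (hw z hz).ne', hz⟩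
  · obtain ⟨-, hv⟩ := hasIntegral_gammaFunctional ha hb
      (Polynomial.X * (q * q.map (starRingEnd ℂ)))
    simp only [Polynomial.eval_mul (p := Polynomial.X), Polynomial.eval_X, heval, ← Complex.ofReal_mul] at hv
    rw [integral_complex_ofReal] at hv
    refine ⟨_, setIntegral_nonpos hS fun z hz => ?_, hv.symm⟩
    have h1 : 0 < z.1 := hz.1
    have h2 : 0 < z.2 := hz.2
    have h3 : 0 ≤ z.1 * z.2 * (Complex.normSq (q.eval ((-4 * z.1 * z.2 : ℝ) : ℂ))
        * gammaWeight a b z) :=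
      mul_nonneg (by positivity) (mul_nonneg (Complex.normSq_nonneg _) (hw z hz).le)
    nlinarith

/-! ### Parity -/

theorem eq_expand_add_X_mul_expand (p : Polynomial ℂ) :
    p = Polynomial.expand ℂ 2 (Polynomial.contract 2 p)
      + Polynomial.X * Polynomial.expand ℂ 2 (Polynomial.contract 2 p.divX) := by
  ext n
  rw [Polynomial.coeff_add, Polynomial.coeff_expand two_pos]
  rcases n with _ | n
  · simp [Polynomial.coeff_contract]
  · rw [Polynomial.coeff_X_mul, Polynomial.coeff_expand two_pos]
    rcases Nat.even_or_odd' n with ⟨l, rfl | rfl⟩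
    · rw [if_neg (by omega), if_pos (by omega), Polynomial.coeff_contract two_ne_zero,
        Polynomial.coeff_divX, zero_add]
      congr 1
      omega
    · rw [if_pos (by omega), if_neg (by omega), Polynomial.coeff_contract two_ne_zero, add_zero]
      congr 1
      omega

theorem degree_contract_lt {p : Polynomial ℂ} {n r : ℕ} (hp : p.natDegree ≤ n) (hr : n < 2 * r) :
    (Polynomial.contract 2 p).degree < r := by
  refine (Polynomial.degree_lt_iff_coeff_zero _ _).2 fun l hl => ?_
  rw [Polynomial.coeff_contract two_ne_zero]
  exact Polynomial.coeff_eq_zero_of_natDegree_lt (by omega)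

theorem degree_contract_divX_lt {p : Polynomial ℂ} {n r : ℕ} (hp : p.natDegree ≤ n)
    (hr : n < 2 * r + 1) : (Polynomial.contract 2 p.divX).degree < r := by
  refine (Polynomial.degree_lt_iff_coeff_zero _ _).2 fun l hl => ?_
  rw [Polynomial.coeff_contract two_ne_zero, Polynomial.coeff_divX]
  exact Polynomial.coeff_eq_zero_of_natDegree_lt (by omega)

theorem monic_expand_two_iff {r : ℕ} {A : Polynomial ℂ} :
    (Polynomial.expand ℂ 2 A).Monic ∧ (Polynomial.expand ℂ 2 A).natDegree = 2 * r ↔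
      A.Monic ∧ A.natDegree = r := by
  rw [Polynomial.monic_expand_iff two_pos, Polynomial.natDegree_expand]
  exact and_congr_right fun _ => by omega

theorem monic_X_mul_expand_two_iff {r : ℕ} {B : Polynomial ℂ} :
    (Polynomial.X * Polynomial.expand ℂ 2 B).Monic ∧
        (Polynomial.X * Polynomial.expand ℂ 2 B).natDegree = 2 * r + 1 ↔
      B.Monic ∧ B.natDegree = r := by
  rw [← monic_expand_two_iff (A := B)]
  constructor
  · rintro ⟨hm, hd⟩
    rw [Polynomial.natDegree_X_mul (right_ne_zero_of_mul hm.ne_zero)] at hd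
    exact ⟨Polynomial.monic_X.of_mul_monic_left hm, by omega⟩
  · rintro ⟨hm, hd⟩
    rw [Polynomial.natDegree_X_mul hm.ne_zero]
    exact ⟨Polynomial.monic_X.mul hm, by omega⟩

theorem expand_mul_X_pow_even (A : Polynomial ℂ) (l : ℕ) :
    Polynomial.expand ℂ 2 A * Polynomial.X ^ (2 * l)
      = Polynomial.expand ℂ 2 (A * Polynomial.X ^ l) := by
  rw [map_mul, map_pow, Polynomial.expand_X, ← pow_mul]

theorem expand_mul_X_pow_odd (A : Polynomial ℂ) (l : ℕ) :
    Polynomial.expand ℂ 2 A * Polynomial.X ^ (2 * l + 1)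
      = Polynomial.X * Polynomial.expand ℂ 2 (A * Polynomial.X ^ l) := by
  rw [map_mul, map_pow, Polynomial.expand_X, ← pow_mul]
  ring

theorem X_mul_expand_mul_X_pow_even (B : Polynomial ℂ) (l : ℕ) :
    Polynomial.X * Polynomial.expand ℂ 2 B * Polynomial.X ^ (2 * l)
      = Polynomial.X * Polynomial.expand ℂ 2 (B * Polynomial.X ^ l) := by
  rw [mul_assoc, expand_mul_X_pow_even]

theorem X_mul_expand_mul_X_pow_odd (B : Polynomial ℂ) (l : ℕ) :
    Polynomial.X * Polynomial.expand ℂ 2 B * Polynomial.X ^ (2 * l + 1)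
      = Polynomial.expand ℂ 2 (B * Polynomial.X ^ l * Polynomial.X) := by
  rw [map_mul, map_mul, map_pow, Polynomial.expand_X, ← pow_mul]
  ring

section Parity

variable {Λ Λ₀ Λ₁ : Polynomial ℂ →ₗ[ℂ] ℂ} {κ κ' : ℂ}

/-- Even `k` tests only `A`, under `Λ₀`; odd `k` tests only `B`, under `Λ₁`, which is `Λ₀` weighted
by `t` up to a constant. Here `B` has degree below `r` and meets `r` conditions. -/
theorem isMonicOrthogonal_even_iff_of_even (h0 : IsPositiveOnNegAxis Λ₁) (hκ : κ ≠ 0)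
    (hκ' : κ' ≠ 0) (he : ∀ A, Λ (Polynomial.expand ℂ 2 A) = κ * Λ₀ A)
    (ho : ∀ B, Λ (Polynomial.X * Polynomial.expand ℂ 2 B) = 0)
    (he' : ∀ B, Λ (Polynomial.expand ℂ 2 (B * Polynomial.X)) = κ' * Λ₁ B) (r : ℕ)
    (p : Polynomial ℂ) :
    IsMonicOrthogonal Λ (2 * r) p ↔
      ∃ A, p = Polynomial.expand ℂ 2 A ∧ IsMonicOrthogonal Λ₀ r A := by
  constructor
  · rintro ⟨hm, hd, h⟩
    have hp := eq_expand_add_X_mul_expand p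
    set A := Polynomial.contract 2 p
    set B := Polynomial.contract 2 p.divX
    have hB : B = 0 := by
      refine h0.eq_zero (n := r) (degree_contract_divX_lt hd.le (by omega)) fun l hl => ?_
      have h1 := h (2 * l + 1) (by omega)
      rw [hp, add_mul, map_add, expand_mul_X_pow_odd, ho, X_mul_expand_mul_X_pow_odd, he',
        zero_add] at h1
      exact (mul_eq_zero.1 h1).resolve_left hκ'
    rw [hB, map_zero, mul_zero, add_zero] at hp
    rw [hp] at hm hd
    obtain ⟨hmA, hdA⟩ := monic_expand_two_iff.1 ⟨hm, hd⟩
    refine ⟨A, hp, hmA, hdA, fun l hl => ?_⟩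
    have h1 := h (2 * l) (by omega)
    rw [hp, expand_mul_X_pow_even, he] at h1
    exact (mul_eq_zero.1 h1).resolve_left hκ
  · rintro ⟨A, rfl, hmA, hdA, hA⟩
    obtain ⟨hm, hd⟩ := monic_expand_two_iff.2 ⟨hmA, hdA⟩
    refine ⟨hm, hd, fun k hk => ?_⟩
    rcases Nat.even_or_odd' k with ⟨l, rfl | rfl⟩
    · rw [expand_mul_X_pow_even, he, hA l (by omega), mul_zero]
    · rw [expand_mul_X_pow_odd, ho]

/-- Now `k = 2l < 2r + 1` allows `l = r`: the `r + 1` conditions kill `A`, of degree at most `r`. -/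
theorem isMonicOrthogonal_odd_iff_of_even (h0 : IsPositiveOnNegAxis Λ₀) (hκ : κ ≠ 0)
    (hκ' : κ' ≠ 0) (he : ∀ A, Λ (Polynomial.expand ℂ 2 A) = κ * Λ₀ A)
    (ho : ∀ B, Λ (Polynomial.X * Polynomial.expand ℂ 2 B) = 0)
    (he' : ∀ B, Λ (Polynomial.expand ℂ 2 (B * Polynomial.X)) = κ' * Λ₁ B) (r : ℕ)
    (p : Polynomial ℂ) :
    IsMonicOrthogonal Λ (2 * r + 1) p ↔
      ∃ B, p = Polynomial.X * Polynomial.expand ℂ 2 B ∧ IsMonicOrthogonal Λ₁ r B := by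
  constructor
  · rintro ⟨hm, hd, h⟩
    have hp := eq_expand_add_X_mul_expand p
    set A := Polynomial.contract 2 p
    set B := Polynomial.contract 2 p.divX
    have hA : A = 0 := by
      refine h0.eq_zero (n := r + 1) (degree_contract_lt hd.le (by omega)) fun l hl => ?_
      have h1 := h (2 * l) (by omega)
      rw [hp, add_mul, map_add, expand_mul_X_pow_even, he, X_mul_expand_mul_X_pow_even, ho,
        add_zero] at h1
      exact (mul_eq_zero.1 h1).resolve_left hκ
    rw [hA, map_zero, zero_add] at hp
    rw [hp] at hm hd
    obtain ⟨hmB, hdB⟩ := monic_X_mul_expand_two_iff.1 ⟨hm, hd⟩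
    refine ⟨B, hp, hmB, hdB, fun l hl => ?_⟩
    have h1 := h (2 * l + 1) (by omega)
    rw [hp, X_mul_expand_mul_X_pow_odd, he'] at h1
    exact (mul_eq_zero.1 h1).resolve_left hκ'
  · rintro ⟨B, rfl, hmB, hdB, hB⟩
    obtain ⟨hm, hd⟩ := monic_X_mul_expand_two_iff.2 ⟨hmB, hdB⟩
    refine ⟨hm, hd, fun k hk => ?_⟩
    rcases Nat.even_or_odd' k with ⟨l, rfl | rfl⟩
    · rw [X_mul_expand_mul_X_pow_even, ho]
    · rw [X_mul_expand_mul_X_pow_odd, he', hB l (by omega), mul_zero]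

/-- With even moments zero the roles swap: even `k` tests `B` and odd `k` tests `A`, both under
`Λ₀`. -/
theorem isMonicOrthogonal_even_iff_of_odd (h0 : IsPositiveOnNegAxis Λ₀) (hκ : κ ≠ 0)
    (he : ∀ A, Λ (Polynomial.expand ℂ 2 A) = 0)
    (ho : ∀ B, Λ (Polynomial.X * Polynomial.expand ℂ 2 B) = κ * Λ₀ B) (r : ℕ)
    (p : Polynomial ℂ) :
    IsMonicOrthogonal Λ (2 * r) p ↔
      ∃ A, p = Polynomial.expand ℂ 2 A ∧ IsMonicOrthogonal Λ₀ r A := by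
  constructor
  · rintro ⟨hm, hd, h⟩
    have hp := eq_expand_add_X_mul_expand p
    set A := Polynomial.contract 2 p
    set B := Polynomial.contract 2 p.divX
    have hB : B = 0 := by
      refine h0.eq_zero (n := r) (degree_contract_divX_lt hd.le (by omega)) fun l hl => ?_
      have h1 := h (2 * l) (by omega)
      rw [hp, add_mul, map_add, expand_mul_X_pow_even, he, X_mul_expand_mul_X_pow_even, ho,
        zero_add] at h1
      exact (mul_eq_zero.1 h1).resolve_left hκ
    rw [hB, map_zero, mul_zero, add_zero] at hp
    rw [hp] at hm hd
    obtain ⟨hmA, hdA⟩ := monic_expand_two_iff.1 ⟨hm, hd⟩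
    refine ⟨A, hp, hmA, hdA, fun l hl => ?_⟩
    have h1 := h (2 * l + 1) (by omega)
    rw [hp, expand_mul_X_pow_odd, ho] at h1
    exact (mul_eq_zero.1 h1).resolve_left hκ
  · rintro ⟨A, rfl, hmA, hdA, hA⟩
    obtain ⟨hm, hd⟩ := monic_expand_two_iff.2 ⟨hmA, hdA⟩
    refine ⟨hm, hd, fun k hk => ?_⟩
    rcases Nat.even_or_odd' k with ⟨l, rfl | rfl⟩
    · rw [expand_mul_X_pow_even, he]
    · rw [expand_mul_X_pow_odd, ho, hA l (by omega), mul_zero]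

/-- The tests `l = 0, …, r` force `B = 0`, leaving `p` of even degree. -/
theorem not_isMonicOrthogonal_odd_of_odd (h0 : IsPositiveOnNegAxis Λ₀) (hκ : κ ≠ 0)
    (he : ∀ A, Λ (Polynomial.expand ℂ 2 A) = 0)
    (ho : ∀ B, Λ (Polynomial.X * Polynomial.expand ℂ 2 B) = κ * Λ₀ B) (r : ℕ)
    (p : Polynomial ℂ) : ¬ IsMonicOrthogonal Λ (2 * r + 1) p := by
  rintro ⟨hm, hd, h⟩
  have hp := eq_expand_add_X_mul_expand p
  set A := Polynomial.contract 2 p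
  set B := Polynomial.contract 2 p.divX
  have hB : B = 0 := by
    refine h0.eq_zero (n := r + 1) (degree_contract_divX_lt hd.le (by omega)) fun l hl => ?_
    have h1 := h (2 * l) (by omega)
    rw [hp, add_mul, map_add, expand_mul_X_pow_even, he, X_mul_expand_mul_X_pow_even, ho,
      zero_add] at h1
    exact (mul_eq_zero.1 h1).resolve_left hκ
  rw [hB, map_zero, mul_zero, add_zero] at hp
  have hdA := congrArg Polynomial.natDegree hp
  rw [hd, Polynomial.natDegree_expand] at hdA
  omega

end Parity

/-! ### Uniqueness and zeros under the substitution `t = x²` -/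

theorem existsUnique_expand {Λ Λ₀ : Polynomial ℂ →ₗ[ℂ] ℂ} (h0 : IsPositiveOnNegAxis Λ₀)
    {f : Polynomial ℂ → Polynomial ℂ} {n r : ℕ}
    (h : ∀ p, IsMonicOrthogonal Λ n p ↔ ∃ A, p = f A ∧ IsMonicOrthogonal Λ₀ r A) :
    ∃! p, IsMonicOrthogonal Λ n p := by
  obtain ⟨A, hA, huniq⟩ := h0.existsUnique r
  refine ⟨f A, (h _).2 ⟨A, rfl, hA⟩, fun p hp => ?_⟩
  obtain ⟨A', rfl, hA'⟩ := (h p).1 hp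
  rw [huniq A' hA']

theorem Complex.re_eq_zero_of_sq_eq_ofReal {z : ℂ} {t : ℝ} (ht : t ≤ 0) (h : z ^ 2 = t) :
    z.re = 0 := by
  have h1 := congrArg Complex.re h
  have h2 := congrArg Complex.im h
  rw [sq, Complex.mul_re, Complex.ofReal_re] at h1
  rw [sq, Complex.mul_im, Complex.ofReal_im] at h2
  rcases mul_eq_zero.1 (show z.re * z.im = 0 by linarith) with h3 | h3
  · exact h3
  · rw [h3] at h1
    nlinarith

theorem re_eq_zero_of_isRoot_expand {Λ : Polynomial ℂ →ₗ[ℂ] ℂ} (hΛ : IsPositiveOnNegAxis Λ)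
    {r : ℕ} {A : Polynomial ℂ} (hA : IsMonicOrthogonal Λ r A) {z : ℂ}
    (hz : (Polynomial.expand ℂ 2 A).IsRoot z) : z.re = 0 := by
  rw [Polynomial.IsRoot, Polynomial.expand_eval] at hz
  obtain ⟨t, ht, htz⟩ := hΛ.exists_ofReal_of_isRoot hA hz
  exact Complex.re_eq_zero_of_sq_eq_ofReal ht htz

theorem rootMultiplicity_le_rootMultiplicity_neg {p : Polynomial ℂ} {ε : ℂ} (hε : ε ≠ 0)
    (h : ∀ z, p.eval (-z) = ε * p.eval z) (z : ℂ) :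
    p.rootMultiplicity z ≤ p.rootMultiplicity (-z) := by
  rcases eq_or_ne p 0 with rfl | hp
  · simp
  have hcomp : p.comp (-Polynomial.X) = Polynomial.C ε * p :=
    Polynomial.funext fun w => by simp [h]
  rw [Polynomial.le_rootMultiplicity_iff hp]
  obtain ⟨q, hq⟩ := Polynomial.pow_rootMultiplicity_dvd p z
  set n := p.rootMultiplicity z
  have h1 : Polynomial.C ε * p = (-1) ^ n * (Polynomial.X - Polynomial.C (-z)) ^ n
      * q.comp (-Polynomial.X) := by
    rw [← hcomp]
    conv_lhs => rw [hq]
    rw [Polynomial.mul_comp, Polynomial.pow_comp, Polynomial.sub_comp, Polynomial.X_comp,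
      Polynomial.C_comp, ← mul_pow]
    congr 2
    simp
    ring
  refine ⟨Polynomial.C ε⁻¹ * ((-1) ^ n * q.comp (-Polynomial.X)), ?_⟩
  have h2 : Polynomial.C ε⁻¹ * (Polynomial.C ε * p) = p := by
    rw [← mul_assoc, ← Polynomial.C_mul, inv_mul_cancel₀ hε, Polynomial.C_1, one_mul]
  rw [← h2, h1]
  ring

/-- On the imaginary axis conjugation is negation, under which `p` is invariant up to a factor; off
it both multiplicities are zero. -/
theorem rootMultiplicity_conj {p : Polynomial ℂ} {ε : ℂ} (hε : ε ≠ 0)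
    (h : ∀ z, p.eval (-z) = ε * p.eval z) (hre : ∀ z, p.IsRoot z → z.re = 0) (z : ℂ) :
    p.rootMultiplicity (starRingEnd ℂ z) = p.rootMultiplicity z := by
  by_cases hz : z.re = 0
  · have hconj : starRingEnd ℂ z = -z := by
      apply Complex.ext <;> simp [hz]
    rw [hconj]
    refine le_antisymm ?_ (rootMultiplicity_le_rootMultiplicity_neg hε h z)
    simpa using rootMultiplicity_le_rootMultiplicity_neg hε h (-z)
  · rw [Polynomial.rootMultiplicity_eq_zero fun h' => hz (by simpa using hre _ h'),
      Polynomial.rootMultiplicity_eq_zero fun h' => hz (hre _ h')]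

/-! ### The moments of the Bessel function -/

theorem besselMoment_two_mul_add (ν : ℝ) (h l : ℕ) :
    besselMoment ν (2 * h + 2 * l) = (-4) ^ h * 2 ^ ν / Real.pi
      * ((-4) ^ l * Real.Gamma (ν + h + 1 / 2 + l) * Real.Gamma (h + 1 / 2 + l)) := by
  rw [besselMoment, if_pos (by simp [parity_simps]), show (2 * h + 2 * l) / 2 = h + l by omega]
  push_cast
  rw [show ν + ((h : ℝ) + l) + 1 / 2 = ν + h + 1 / 2 + l by ring,
    show (h : ℝ) + l + 1 / 2 = h + 1 / 2 + l by ring]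
  ring

theorem besselMoment_of_odd (ν : ℝ) {M : ℕ} (hM : Odd M) : besselMoment ν M = 0 :=
  if_neg (Nat.not_even_iff_odd.2 hM)

theorem momentFunctional_besselMoment (ν : ℝ) (h : ℕ) (p : Polynomial ℂ) :
    momentFunctional (fun l => (besselMoment ν (2 * h + 2 * l) : ℂ)) p
      = (((-4) ^ h * 2 ^ ν / Real.pi : ℝ) : ℂ)
        * gammaFunctional (ν + h + 1 / 2) (h + 1 / 2) p := by
  rw [gammaFunctional, ← momentFunctional_const_mul]
  congr 2
  funext l
  rw [besselMoment_two_mul_add, Complex.ofReal_mul]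

theorem momentFunctional_zero {c : ℕ → ℂ} (hc : ∀ j, c j = 0) (p : Polynomial ℂ) :
    momentFunctional c p = 0 := by
  rw [momentFunctional_apply]
  exact Finset.sum_eq_zero fun j _ => by rw [hc, mul_zero]

theorem besselMoment_const_ne_zero (ν : ℝ) (h : ℕ) :
    (((-4) ^ h * 2 ^ ν / Real.pi : ℝ) : ℂ) ≠ 0 := by
  have := Real.pi_pos
  have h2 : (2 : ℝ) ^ ν ≠ 0 := by positivity
  exact Complex.ofReal_ne_zero.2 <| div_ne_zero (mul_ne_zero (pow_ne_zero _ (by norm_num)) h2) this.ne'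

/-- Multiplication by `t` shifts the moment sequence by one, raising both Gamma parameters by 1;
hence `h + 1` in the odd-degree case. -/
theorem isMonicOrthogonal_bessel_of_even {ν : ℝ} {h : ℕ} (hν : 0 < ν + h + 1 / 2) (r : ℕ)
    (p : Polynomial ℂ) :
    (IsMonicOrthogonal (momentFunctional fun j => (besselMoment ν (2 * h + j) : ℂ)) (2 * r) p ↔
      ∃ A, p = Polynomial.expand ℂ 2 A ∧
        IsMonicOrthogonal (gammaFunctional (ν + h + 1 / 2) (h + 1 / 2)) r A) ∧
    (IsMonicOrthogonal (momentFunctional fun j => (besselMoment ν (2 * h + j) : ℂ)) (2 * r + 1) p ↔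
      ∃ B, p = Polynomial.X * Polynomial.expand ℂ 2 B ∧
        IsMonicOrthogonal (gammaFunctional (ν + (h + 1 : ℕ) + 1 / 2) ((h + 1 : ℕ) + 1 / 2)) r B) := by
  have he : ∀ A, momentFunctional (fun j => (besselMoment ν (2 * h + j) : ℂ))
      (Polynomial.expand ℂ 2 A) = (((-4) ^ h * 2 ^ ν / Real.pi : ℝ) : ℂ)
        * gammaFunctional (ν + h + 1 / 2) (h + 1 / 2) A := fun A => by
    rw [momentFunctional_expand, momentFunctional_besselMoment]
  have ho : ∀ B, momentFunctional (fun j => (besselMoment ν (2 * h + j) : ℂ))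
      (Polynomial.X * Polynomial.expand ℂ 2 B) = 0 := fun B => by
    rw [momentFunctional_X_mul_expand]
    exact momentFunctional_zero (fun l => by
      rw [besselMoment_of_odd ν ⟨h + l, by ring⟩, Complex.ofReal_zero]) B
  have he' : ∀ B, momentFunctional (fun j => (besselMoment ν (2 * h + j) : ℂ))
      (Polynomial.expand ℂ 2 (B * Polynomial.X))
        = (((-4) ^ (h + 1) * 2 ^ ν / Real.pi : ℝ) : ℂ)
        * gammaFunctional (ν + (h + 1 : ℕ) + 1 / 2) ((h + 1 : ℕ) + 1 / 2) B := fun B => by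
    rw [momentFunctional_expand, ← pow_one Polynomial.X, momentFunctional_mul_X_pow,
      ← momentFunctional_besselMoment]
    congr 2
    funext l
    ring_nf
  have hpos := isPositiveOnNegAxis_gammaFunctional hν
    (show (0 : ℝ) < h + 1 / 2 by positivity)
  have hpos' : IsPositiveOnNegAxis
      (gammaFunctional (ν + (h + 1 : ℕ) + 1 / 2) ((h + 1 : ℕ) + 1 / 2)) :=
    isPositiveOnNegAxis_gammaFunctional (by push_cast; linarith) (by positivity)
  exact ⟨isMonicOrthogonal_even_iff_of_even hpos' (besselMoment_const_ne_zero ν h)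
      (besselMoment_const_ne_zero ν (h + 1)) he ho he' r p,
    isMonicOrthogonal_odd_iff_of_even hpos (besselMoment_const_ne_zero ν h)
      (besselMoment_const_ne_zero ν (h + 1)) he ho he' r p⟩

/-- The first nonzero moment has index `2h + 2`, which is where `h + 1` comes from. -/
theorem isMonicOrthogonal_bessel_of_odd {ν : ℝ} {h : ℕ} (hν : 0 < ν + (h + 1 : ℕ) + 1 / 2) (r : ℕ)
    (p : Polynomial ℂ) :
    (IsMonicOrthogonal (momentFunctional fun j => (besselMoment ν (2 * h + 1 + j) : ℂ)) (2 * r) p ↔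
      ∃ A, p = Polynomial.expand ℂ 2 A ∧
        IsMonicOrthogonal (gammaFunctional (ν + (h + 1 : ℕ) + 1 / 2) ((h + 1 : ℕ) + 1 / 2)) r A) ∧
    ¬ IsMonicOrthogonal (momentFunctional fun j => (besselMoment ν (2 * h + 1 + j) : ℂ))
      (2 * r + 1) p := by
  have he : ∀ A, momentFunctional (fun j => (besselMoment ν (2 * h + 1 + j) : ℂ))
      (Polynomial.expand ℂ 2 A) = 0 := fun A => by
    rw [momentFunctional_expand]
    exact momentFunctional_zero (fun l => by
      rw [besselMoment_of_odd ν ⟨h + l, by ring⟩, Complex.ofReal_zero]) A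
  have ho : ∀ B, momentFunctional (fun j => (besselMoment ν (2 * h + 1 + j) : ℂ))
      (Polynomial.X * Polynomial.expand ℂ 2 B) = (((-4) ^ (h + 1) * 2 ^ ν / Real.pi : ℝ) : ℂ)
        * gammaFunctional (ν + (h + 1 : ℕ) + 1 / 2) ((h + 1 : ℕ) + 1 / 2) B := fun B => by
    rw [momentFunctional_X_mul_expand, ← momentFunctional_besselMoment]
    congr 2
    funext l
    ring_nf
  have hpos : IsPositiveOnNegAxis
      (gammaFunctional (ν + (h + 1 : ℕ) + 1 / 2) ((h + 1 : ℕ) + 1 / 2)) :=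
    isPositiveOnNegAxis_gammaFunctional hν (by positivity)
  exact ⟨isMonicOrthogonal_even_iff_of_odd hpos (besselMoment_const_ne_zero ν (h + 1)) he ho r p,
    not_isMonicOrthogonal_odd_of_odd hpos (besselMoment_const_ne_zero ν (h + 1)) he ho r p⟩

/-! ### Parity, zeros and the conclusion -/

theorem eval_neg_expand (A : Polynomial ℂ) (z : ℂ) :
    (Polynomial.expand ℂ 2 A).eval (-z) = (Polynomial.expand ℂ 2 A).eval z := by
  rw [Polynomial.expand_eval, Polynomial.expand_eval, neg_sq]

theorem eval_neg_X_mul_expand (B : Polynomial ℂ) (z : ℂ) :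
    (Polynomial.X * Polynomial.expand ℂ 2 B).eval (-z)
      = -(Polynomial.X * Polynomial.expand ℂ 2 B).eval z := by
  rw [Polynomial.eval_mul, Polynomial.eval_mul, eval_neg_expand, Polynomial.eval_X,
    Polynomial.eval_X, neg_mul]

theorem zeros_expand {Λ : Polynomial ℂ →ₗ[ℂ] ℂ} (hΛ : IsPositiveOnNegAxis Λ)
    {r : ℕ} {A : Polynomial ℂ} (hA : IsMonicOrthogonal Λ r A) :
    (∀ z : ℂ, (Polynomial.expand ℂ 2 A).IsRoot z → z.re = 0) ∧
      ∀ z : ℂ, (Polynomial.expand ℂ 2 A).rootMultiplicity (starRingEnd ℂ z)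
        = (Polynomial.expand ℂ 2 A).rootMultiplicity z :=
  have h := fun z => re_eq_zero_of_isRoot_expand hΛ hA (z := z)
  ⟨h, rootMultiplicity_conj one_ne_zero (fun z => by rw [eval_neg_expand, one_mul]) h⟩

theorem zeros_X_mul_expand {Λ : Polynomial ℂ →ₗ[ℂ] ℂ} (hΛ : IsPositiveOnNegAxis Λ)
    {r : ℕ} {B : Polynomial ℂ} (hB : IsMonicOrthogonal Λ r B) :
    (∀ z : ℂ, (Polynomial.X * Polynomial.expand ℂ 2 B).IsRoot z → z.re = 0) ∧
      ∀ z : ℂ, (Polynomial.X * Polynomial.expand ℂ 2 B).rootMultiplicity (starRingEnd ℂ z)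
        = (Polynomial.X * Polynomial.expand ℂ 2 B).rootMultiplicity z := by
  have h : ∀ z : ℂ, (Polynomial.X * Polynomial.expand ℂ 2 B).IsRoot z → z.re = 0 := by
    intro z hz
    rcases Polynomial.root_mul.1 hz with h0 | h0
    · rw [Polynomial.IsRoot, Polynomial.eval_X] at h0
      rw [h0, Complex.zero_re]
    · exact re_eq_zero_of_isRoot_expand hΛ hB h0
  exact ⟨h, rootMultiplicity_conj (neg_ne_zero.2 one_ne_zero)
    (fun z => by rw [eval_neg_X_mul_expand, neg_one_mul]) h⟩

theorem mainTheorem5 (μ ν : ℝ) (hμν : -1 < μ + ν) (m : ℕ) (hm : μ - ν = (m : ℝ)) :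
    (Even m → ∀ n : ℕ,
      (∃! p : Polynomial ℂ, IsBesselOrthogonal μ ν n p) ∧
      ∀ p : Polynomial ℂ, IsBesselOrthogonal μ ν n p →
        (Even n → ∀ z : ℂ, p.eval (-z) = p.eval z) ∧
        (Odd n → ∀ z : ℂ, p.eval (-z) = -p.eval z)) ∧
    (Odd m → ∀ n : ℕ,
      (Even n → ∃! p : Polynomial ℂ, IsBesselOrthogonal μ ν n p) ∧
      (Odd n → ¬ ∃ p : Polynomial ℂ, IsBesselOrthogonal μ ν n p) ∧
      ∀ p : Polynomial ℂ, IsBesselOrthogonal μ ν n p → ∀ z : ℂ, p.eval (-z) = p.eval z) ∧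
    (∀ (n : ℕ) (p : Polynomial ℂ), IsBesselOrthogonal μ ν n p →
      (∀ z : ℂ, p.IsRoot z → z.re = 0) ∧
      (∀ z : ℂ, p.rootMultiplicity (starRingEnd ℂ z) = p.rootMultiplicity z)) := by
  simp only [isBesselOrthogonal_iff hμν hm]
  have hpos : ∀ {h : ℕ}, 0 < ν + h + 1 / 2 →
      IsPositiveOnNegAxis (gammaFunctional (ν + h + 1 / 2) (h + 1 / 2)) := fun hh =>
    isPositiveOnNegAxis_gammaFunctional hh (by positivity)
  rcases Nat.even_or_odd' m with ⟨h, rfl | rfl⟩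
  -- As `μ + ν = 2ν + 2h`, this is exactly the hypothesis `μ + ν > -1`.
  · have hν : 0 < ν + h + 1 / 2 := by push_cast at hm; linarith
    have hν' : 0 < ν + (h + 1 : ℕ) + 1 / 2 := by push_cast; linarith
    have key := isMonicOrthogonal_bessel_of_even hν
    refine ⟨fun _ n => ?_, fun ho => absurd ho (by simp), fun n p hp => ?_⟩
    · rcases Nat.even_or_odd' n with ⟨r, rfl | rfl⟩
      · refine ⟨existsUnique_expand (hpos hν) fun p => (key r p).1,
          fun p hp => ⟨fun _ => ?_, fun ho => absurd ho (by simp)⟩⟩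
        obtain ⟨A, rfl, -⟩ := (key r p).1.1 hp
        exact eval_neg_expand A
      · refine ⟨existsUnique_expand (hpos hν') fun p => (key r p).2,
          fun p hp => ⟨fun he => absurd he (by simp), fun _ => ?_⟩⟩
        obtain ⟨B, rfl, -⟩ := (key r p).2.1 hp
        exact eval_neg_X_mul_expand B
    · rcases Nat.even_or_odd' n with ⟨r, rfl | rfl⟩
      · obtain ⟨A, rfl, hA⟩ := (key r p).1.1 hp
        exact zeros_expand (hpos hν) hA
      · obtain ⟨B, rfl, hB⟩ := (key r p).2.1 hp
        exact zeros_X_mul_expand (hpos hν') hB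
  · have hν : 0 < ν + (h + 1 : ℕ) + 1 / 2 := by push_cast at *; linarith
    have key := isMonicOrthogonal_bessel_of_odd hν
    refine ⟨fun he => absurd he (by simp), fun _ n => ?_, fun n p hp => ?_⟩
    · rcases Nat.even_or_odd' n with ⟨r, rfl | rfl⟩
      · refine ⟨fun _ => existsUnique_expand (hpos hν) fun p => (key r p).1,
          fun ho => absurd ho (by simp), fun p hp => ?_⟩
        obtain ⟨A, rfl, -⟩ := (key r p).1.1 hp
        exact eval_neg_expand A
      · exact ⟨fun he => absurd he (by simp), fun _ ⟨p, hp⟩ => (key r p).2 hp,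
          fun p hp => absurd hp (key r p).2⟩
    · rcases Nat.even_or_odd' n with ⟨r, rfl | rfl⟩
      · obtain ⟨A, rfl, hA⟩ := (key r p).1.1 hp
        exact zeros_expand (hpos hν) hA
      · exact absurd hp (key r p).2
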